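/- A permutation of length $n$ is written in one-line notation as a list $p$ of the numbers $1,\dots,n$. A pattern is a finite list $q$ of distinct real numbers; $p$ contains $q$ if some subsequence of $p$ has the same length and the same relative order as $q$, and avoids $q$ otherwise. The $it$-encoding represents permutations of length $n\ge 1$ by words over $\{l,r,m,f,t\}$. Start with $p=\diamond$ (one open slot), and read the word from left to right, with next entry $i=1$ and next slot the leftmost one. The letter $t$ moves the next slot one slot to the right. The letters $l,r,m,f$ replace the next slot by $i\,\diamond$, by $\diamond\, i$, by $\diamond\, i\,\diamond$ and by $i$, respectively, after which $i$ increases by $1$ and the next slot is again the leftmost one. A word is a codeword if (i) each letter $x\ne t$ in it is immediately preceded by at most $k$ letters $t$, where $k$ is the number of $m$ minus the number of $f$ to the left of $x$ (so $k\ge 0$), (ii) its last letter is $f$, and (iii) no slot is open at the end, i.e. $\#f=\#m+1$. Let $E$ be the set of codewords, and $E(q)$ the set of codewords that represent permutations avoiding $q$. **Corollary.** Let $q_1,\dots,q_k$ be a finite list of patterns, and let $L$ be the set of codewords that represent permutations avoiding all of $q_1,\dots,q_k$. Then: 1. $L$ is accepted by a linear-bounded automaton in polynomial time: there are a nondeterministic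 one-tape Turing machine $M$ and a polynomial $P$ such that $M$ accepts exactly the words of $L$, and on every input word $w$ every computation of $M$ uses only $|w|+1$ squares of tape (those of the input and one more) and halts within $P(|w|)$ steps. 2. $L=E\cap E(q_1)\cap\dots\cap E(q_k)$, and if $k\ge 1$, then $L=E(q_1)\cap\dots\cap E(q_k)$. 3. The map that sends a codeword to the permutation it represents is a bijection from $L$ onto the set of all permutations of $1,\dots,n$, $n\ge 1$, that avoid all of $q_1,\dots,q_k$. 4. $L$ is a context-sensitive language: it is generated by a grammar with finitely many nonterminals and finitely many productions $\alpha\to\beta$, in each of which $\alpha$ contains a nonterminal and $|\alpha|\le|\beta|$. So every finitely based class of (nonempty) permutations is in bijection with a context-sensitive language. -/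

import Mathlib

/-! ### Permutations as lists, and pattern containment -/

/-- Two finite lists have the same length and the same relative order of their entries
(for lists of distinct numbers: they are order isomorphic). -/
def OrderIsomorphic {α β : Type*} [LinearOrder α] [LinearOrder β] (p : List α) (q : List β) :
    Prop :=
  ∃ h : p.length = q.length, ∀ i j : Fin p.length, i < j →
    (p.get i < p.get j ↔ q.get (i.cast h) < q.get (j.cast h))

/-- `p` contains the pattern `q`: some (not necessarily contiguous) subsequence of `p` is order
isomorphic to `q`. -/
def ContainsPattern {α β : Type*} [LinearOrder α] [LinearOrder β] (p : List α) (q : List β) :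
    Prop :=
  ∃ s : List α, s.Sublist p ∧ OrderIsomorphic s q

/-- `p` avoids the pattern `q`. -/
def AvoidsPattern {α β : Type*} [LinearOrder α] [LinearOrder β] (p : List α) (q : List β) :
    Prop :=
  ¬ ContainsPattern p q

/-- The pattern-avoiding class of a finite list `B` of patterns: all permutations of
`1, …, n` (in one-line notation), `n ≥ 1`, that avoid every pattern of `B`. -/
def avoidanceClass (B : List (List ℝ)) : Set (List ℕ) :=
  {p | p ≠ [] ∧ p.Perm (List.range' 1 p.length) ∧ ∀ q ∈ B, AvoidsPattern p q}

/-! ### The insert-and-translate encoding -/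

/-- The alphabet: insert on the left of a slot, on its right, in its middle, fill the slot,
translate to the next slot. -/
inductive Letter
  | l | r | m | f | t
  deriving DecidableEq

/-- A legal codeword: whenever `j` letters `t` stand immediately before a letter `x ≠ t`, then
`j ≤ (number of m) - (number of f)` to the left of `x` (an integer difference; the case `j = 0`
says that there is an open slot); the word ends with an `f`, and at its end
every slot is filled: `1 + (number of m) - (number of f) = 0`. -/
def IsCodeword (w : List Letter) : Prop :=
  (∀ (u v : List Letter) (j : ℕ) (x : Letter), x ≠ Letter.t →
      w = u ++ List.replicate j Letter.t ++ x :: v →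
      (j : ℤ) ≤ (u.count Letter.m : ℤ) - (u.count Letter.f : ℤ)) ∧
  (∃ u : List Letter, w = u ++ [Letter.f]) ∧
  w.count Letter.f = w.count Letter.m + 1

/-- In a partially built permutation (`none` is an open slot `⋄`), replace the open slot that has
exactly `s` open slots on its left by the list `new`. (No change if there is no such slot.) -/
def replaceSlot (new : List (Option ℕ)) : ℕ → List (Option ℕ) → List (Option ℕ)
  | _, [] => []
  | s, some a :: p => some a :: replaceSlot new s p
  | 0, none :: p => new ++ p
  | s + 1, none :: p => none :: replaceSlot new s p

/-- Run the instructions of a word: `i` is the next entry, `s` is the number of slots to the left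
of the next slot, and `p` is the partially built permutation. -/
def insertLetters : List Letter → ℕ → ℕ → List (Option ℕ) → List (Option ℕ)
  | [], _, _, p => p
  | Letter.t :: w, i, s, p => insertLetters w i (s + 1) p
  | Letter.l :: w, i, s, p => insertLetters w (i + 1) 0 (replaceSlot [some i, none] s p)
  | Letter.r :: w, i, s, p => insertLetters w (i + 1) 0 (replaceSlot [none, some i] s p)
  | Letter.m :: w, i, s, p => insertLetters w (i + 1) 0 (replaceSlot [none, some i, none] s p)
  | Letter.f :: w, i, s, p => insertLetters w (i + 1) 0 (replaceSlot [some i] s p)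

/-- The permutation represented by a word: start from a single open slot with next entry `1`, run
all instructions, and read off the entries (for a codeword no open slot is left). -/
def decode (w : List Letter) : List ℕ :=
  (insertLetters w 1 0 [none]).reduceOption

/-- The language of all legal codewords. -/
def codewords : Language Letter := {w | IsCodeword w}

/-- `E(q)`: the codewords that represent permutations avoiding `q`. -/
def codewordsAvoiding (q : List ℝ) : Language Letter :=
  {w | IsCodeword w ∧ AvoidsPattern (decode w) q}

/-- The codewords that represent permutations avoiding every pattern of `B`. -/
def codewordsAvoidingAll (B : List (List ℝ)) : Language Letter :=
  {w | IsCodeword w ∧ ∀ q ∈ B, AvoidsPattern (decode w) q}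

/-! ### Nondeterministic Turing machines and linear-bounded automata -/

/-- Movements of the head of a Turing machine. -/
inductive HeadMove
  | left | stay | right

/-- The displacement of the head. -/
def HeadMove.shift : HeadMove → ℤ
  | HeadMove.left => -1
  | HeadMove.stay => 0
  | HeadMove.right => 1

/-- A nondeterministic one-tape Turing machine with input alphabet `A`. Tape squares hold elements
of `Option Sym`, where `none` is the blank. The machine halts where `trans` is empty. -/
structure NTM (A : Type) where
  State : Type
  Sym : Type
  finiteState : Finite State
  finiteSym : Finite Sym
  input : A ↪ Sym
  start : State
  accept : Set State
  trans : State → Option Sym → Set (State × Option Sym × HeadMove)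

namespace NTM

variable {A : Type}

/-- A configuration: the state, the position of the head and the contents of the tape, which is
infinite in both directions. -/
structure Config (M : NTM A) where
  state : M.State
  head : ℤ
  tape : ℤ → Option M.Sym

/-- The initial configuration: the input is written on the squares `0, …, |w| - 1`, all other
squares are blank, and the head is on the square `0`. -/
def init (M : NTM A) (w : List A) : M.Config where
  state := M.start
  head := 0
  tape := fun z => if 0 ≤ z then (w[z.toNat]?).map M.input else none

/-- One step of a computation. -/
def Step (M : NTM A) (c d : M.Config) : Prop :=
  ∃ (q : M.State) (a : Option M.Sym) (v : HeadMove),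
    (q, a, v) ∈ M.trans c.state (c.tape c.head) ∧
    d = ⟨q, c.head + v.shift, Function.update c.tape c.head a⟩

/-- `M.StepsTo n c d`: some computation of exactly `n` steps leads from `c` to `d`. -/
def StepsTo (M : NTM A) : ℕ → M.Config → M.Config → Prop
  | 0, c, d => c = d
  | n + 1, c, d => ∃ e, M.Step c e ∧ M.StepsTo n e d

/-- The accepted language: the words from which some computation reaches an accepting state. -/
def language (M : NTM A) : Language A :=
  {w | ∃ (n : ℕ) (c : M.Config), M.StepsTo n (M.init w) c ∧ c.state ∈ M.accept}

/-- The machine is linear-bounded: on an input `w`, no computation leaves the `|w| + 1` squares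
`0, …, |w|` (the squares of the input and one more). -/
def IsLinearBounded (M : NTM A) : Prop :=
  ∀ (w : List A) (n : ℕ) (c : M.Config), M.StepsTo n (M.init w) c →
    0 ≤ c.head ∧ c.head ≤ (w.length : ℤ)

/-- The machine runs in polynomial time: every computation on an input `w` halts within `P(|w|)`
steps, for some fixed polynomial `P`. -/
def RunsInPolynomialTime (M : NTM A) : Prop :=
  ∃ P : Polynomial ℕ, ∀ (w : List A) (n : ℕ) (c : M.Config), M.StepsTo n (M.init w) c →
    n ≤ P.eval w.length

end NTM

/-! ### Context-sensitive grammars -/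

/-- A context-sensitive grammar with terminals in `A`, in the length-nondecreasing form:
finitely many productions `α → β` with a nonterminal in `α` and `|α| ≤ |β|`. -/
structure ContextSensitiveGrammar (A : Type) where
  NT : Type
  finiteNT : Finite NT
  start : NT
  rules : Set (List (Symbol A NT) × List (Symbol A NT))
  finiteRules : rules.Finite
  hasNonterminal : ∀ ρ ∈ rules, ∃ X : NT, Symbol.nonterminal X ∈ ρ.1
  nondecreasing : ∀ ρ ∈ rules, ρ.1.length ≤ ρ.2.length

namespace ContextSensitiveGrammar

variable {A : Type}

/-- One application of a production. -/
def Produces (g : ContextSensitiveGrammar A) (u v : List (Symbol A g.NT)) : Prop :=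
  ∃ ρ ∈ g.rules, ∃ x y : List (Symbol A g.NT), u = x ++ ρ.1 ++ y ∧ v = x ++ ρ.2 ++ y

/-- The generated language. -/
def language (g : ContextSensitiveGrammar A) : Language A :=
  {w | Relation.ReflTransGen g.Produces [Symbol.nonterminal g.start] (w.map Symbol.terminal)}

end ContextSensitiveGrammar

/-- A language is context-sensitive if a context-sensitive grammar generates it.
(Such a language does not contain the empty word.) -/
def IsContextSensitive {A : Type} (L : Language A) : Prop :=
  ∃ g : ContextSensitiveGrammar A, g.language = L

/-! The encoding. Just before entry `i` is inserted, the open slots are exactly the places where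
entries `≥ i` are still to come. So the partially built permutation is the final one with each
maximal run of entries `≥ i` replaced by a slot (`eq_collapse_of_canComplete`). Slots are therefore
never adjacent, and the letter that inserted `i` can be read off from the slots directly beside `i`:
on the left, on the right, on both sides or on neither. Undoing the insertions from the largest
entry down yields a codeword for every nonempty permutation (`exists_canComplete`), and no step
leaves a choice (`canComplete_unique`). Throughout, legality of a word is used as the recursive
condition `CanComplete`, which follows the number of open slots and the number of slots to the left
of the next one.

The automaton. Entries are inserted in increasing order, so their values compare like the positions
of their letters in the word. An occurrence of a pattern is thus a tuple of positions, for which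
only the left-to-right order of the entries has to be found. For this it suffices to know how many
open slots each marked entry has on its left: if there are `c`, an entry inserted into the slot with
`s` slots on its left lands to the right of the marked entry exactly when `c ≤ s`. With `K` a bound
on the lengths of the patterns, finitely many counters bounded by the length `n` of the word are
enough. A counter machine reads the word once for each of the `(n + 1) ^ K` tuples
(`AvoidCounter.runs_reset`). A Turing machine keeps the counters in unary on tracks of the input
squares and executes one counter step by a sweep to the right and a sweep to the left; the one
additional square marks the right end (`CounterMachine.exists_ntm`). It is deterministic, so one
halting computation per input controls all computations.

The grammar. It generates a word together with the initial tape, rewrites the squares as the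
automaton does, and turns nonterminals into letters once an accepting state has appeared. Erasing
the additional square at the end would shorten the word, so the last nonterminal carries two squares
(`NTM.isContextSensitive`). The empty word causes no exception, as it is not a codeword. -/

/-! ### Runs of the insert-and-translate encoding -/

/-- What a letter puts into the next slot when the next entry is `i`. -/
def slotContent (i : ℕ) : Letter → List (Option ℕ)
  | Letter.l => [some i, none]
  | Letter.r => [none, some i]
  | Letter.m => [none, some i, none]
  | Letter.f => [some i]
  | Letter.t => [none]

/-- The number of open slots after a letter, if there were `N` before it. -/
def slotsAfter (N : ℕ) : Letter → ℕ
  | Letter.m => N + 1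
  | Letter.f => N - 1
  | _ => N

theorem insertLetters_cons (x : Letter) (hx : x ≠ Letter.t) (w : List Letter) (i s : ℕ)
    (p : List (Option ℕ)) :
    insertLetters (x :: w) i s p = insertLetters w (i + 1) 0 (replaceSlot (slotContent i x) s p) := by
  cases x <;> simp_all [insertLetters, slotContent]

theorem insertLetters_replicate_t (j : ℕ) (w : List Letter) (i s : ℕ) (p : List (Option ℕ)) :
    insertLetters (List.replicate j Letter.t ++ w) i s p = insertLetters w i (s + j) p := by
  induction j generalizing s with
  | zero => rfl
  | succ j ih => simp [List.replicate_succ, insertLetters, ih]; congr 1; omega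

/-- Splitting the list at the slot once turns every later claim about the recursion `replaceSlot`
into one about appended lists. -/
theorem exists_replaceSlot (p : List (Option ℕ)) (s : ℕ) (h : s < p.count none) :
    ∃ A B, p = A ++ none :: B ∧ A.count none = s ∧
      ∀ new, replaceSlot new s p = A ++ (new ++ B) := by
  induction p generalizing s with
  | nil => simp at h
  | cons o p ih =>
    cases o with
    | some a =>
      obtain ⟨A, B, h1, h2, h3⟩ := ih s (by simpa using h)
      exact ⟨some a :: A, B, by simp [h1], by simpa using h2, fun new => by simp [replaceSlot, h3]⟩
    | none =>
      cases s with
      | zero => exact ⟨[], p, rfl, rfl, fun new => rfl⟩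
      | succ s =>
        obtain ⟨A, B, h1, h2, h3⟩ := ih s (by simpa using h)
        exact ⟨none :: A, B, by simp [h1], by simpa using h2,
          fun new => by simp [replaceSlot, h3]⟩

theorem replaceSlot_append (new A B : List (Option ℕ)) :
    replaceSlot new (A.count none) (A ++ none :: B) = A ++ (new ++ B) := by
  induction A with
  | nil => simp [replaceSlot]
  | cons o A ih => cases o <;> simp [replaceSlot, ih]

/-- Here `N` counts the other slots; with `N + 1` on the right the truncated subtraction in
`slotsAfter` is harmless. -/
theorem count_slotContent (i : ℕ) {x : Letter} (hx : x ≠ Letter.t) (N : ℕ) :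
    (slotContent i x).count none + N = slotsAfter (N + 1) x := by
  cases x <;> simp_all [slotContent, slotsAfter] <;> omega

theorem count_replaceSlot (i : ℕ) {x : Letter} (hx : x ≠ Letter.t) {s : ℕ} {p : List (Option ℕ)}
    (h : s < p.count none) :
    (replaceSlot (slotContent i x) s p).count none = slotsAfter (p.count none) x := by
  obtain ⟨A, B, h1, -, h3⟩ := exists_replaceSlot p s h
  rw [h3, h1]
  simp only [List.count_append, List.count_cons]
  have := count_slotContent i hx (A.count none + B.count none)
  simp only [beq_self_eq_true, if_true]
  rw [← add_assoc (A.count none) (B.count none), ← this]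
  omega

theorem reduceOption_slotContent (i : ℕ) {x : Letter} (hx : x ≠ Letter.t) :
    (slotContent i x).reduceOption = [i] := by
  cases x <;> simp_all [slotContent, List.reduceOption]

/-- The word `w` can be read to its end when `s` slots are to the left of the next slot and there
are `N` open slots; all of these are filled at the end. -/
def CanComplete : List Letter → ℕ → ℕ → Prop
  | [], s, N => s = 0 ∧ N = 0
  | x :: w, s, N =>
    if x = Letter.t then CanComplete w (s + 1) N else s < N ∧ CanComplete w 0 (slotsAfter N x)

theorem canComplete_cons {x : Letter} (hx : x ≠ Letter.t) (w : List Letter) (s N : ℕ) :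
    CanComplete (x :: w) s N ↔ s < N ∧ CanComplete w 0 (slotsAfter N x) := by
  simp [CanComplete, hx]

theorem canComplete_t (w : List Letter) (s N : ℕ) :
    CanComplete (Letter.t :: w) s N ↔ CanComplete w (s + 1) N := by
  simp [CanComplete]

/-- The conditions on a codeword for words that are read with `N` open slots at the beginning. -/
def IsCompletion (N : ℕ) (w : List Letter) : Prop :=
  (∀ (u v : List Letter) (j : ℕ) (x : Letter), x ≠ Letter.t →
      w = u ++ List.replicate j Letter.t ++ x :: v →
      (j : ℤ) < N + (u.count Letter.m : ℤ) - (u.count Letter.f : ℤ)) ∧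
  (w = [] ∨ ∃ u : List Letter, w = u ++ [Letter.f]) ∧
  w.count Letter.f = w.count Letter.m + N

/-- For `N = 1` the strict bound is the original one, and the alternative `w = []` is excluded by
the count of `f` and `m`. -/
theorem isCodeword_iff_isCompletion (w : List Letter) : IsCodeword w ↔ IsCompletion 1 w := by
  unfold IsCodeword IsCompletion
  constructor
  · rintro ⟨h1, h2, h3⟩
    refine ⟨fun u v j x hx hw => ?_, Or.inr h2, h3⟩
    have := h1 u v j x hx hw
    push_cast; omega
  · rintro ⟨h1, h2, h3⟩
    refine ⟨fun u v j x hx hw => ?_, ?_, h3⟩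
    · have := h1 u v j x hx hw
      push_cast at this; omega
    · rcases h2 with rfl | h2
      · simp at h3
      · exact h2

theorem isCompletion_replicate_t (s N : ℕ) :
    IsCompletion N (List.replicate s Letter.t) ↔ s = 0 ∧ N = 0 := by
  constructor
  · rintro ⟨-, h2, h3⟩
    have : s = 0 := by
      rcases h2 with h | ⟨u, h⟩
      · simpa using h
      · have : Letter.f ∈ List.replicate s Letter.t := by rw [h]; simp
        simp at this
    subst this
    simp at h3
    exact ⟨rfl, h3.symm⟩
  · rintro ⟨rfl, rfl⟩
    exact ⟨by simp, by simp, by simp⟩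

/-- The induction step for `canComplete_iff_isCompletion`. A block condition of the long word either
is one of `w`, with the counts shifted by `x`, or concerns `x` itself, where it follows from `s <
N`. -/
theorem isCompletion_replicate_t_append {x : Letter} (hx : x ≠ Letter.t) (w : List Letter)
    (s N : ℕ) :
    IsCompletion N (List.replicate s Letter.t ++ x :: w) ↔
      s < N ∧ IsCompletion (slotsAfter N x) w := by
  have cast : s < N → (slotsAfter N x : ℤ) = N + (if x = Letter.m then 1 else 0)
      - (if x = Letter.f then 1 else 0) := by
    intro h
    cases x <;> simp [slotsAfter]
    omega
  have cnt : s < N → ∀ w : List Letter, (w.count Letter.f = w.count Letter.m + slotsAfter N x ↔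
      (List.replicate s Letter.t ++ x :: w).count Letter.f =
        (List.replicate s Letter.t ++ x :: w).count Letter.m + N) := by
    intro h w
    cases x <;> simp [slotsAfter, List.count_replicate] at hx ⊢ <;> omega
  constructor
  · rintro ⟨h1, h2, h3⟩
    have hs : s < N := by
      have := h1 [] w s x hx (by simp)
      simpa using this
    refine ⟨hs, fun u v j y hy hw => ?_, ?_, (cnt hs w).2 h3⟩
    · have := h1 (List.replicate s Letter.t ++ x :: u) v j y hy (by simp [hw])
      rw [cast hs]
      simp only [List.count_append, List.count_replicate, List.count_cons] at this
      cases x <;> simp_all <;> omega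
    · rcases List.eq_nil_or_concat w with rfl | ⟨w', y, rfl⟩
      · exact Or.inl rfl
      · right
        rcases h2 with h | ⟨u, h⟩
        · simp at h
        · refine ⟨w', ?_⟩
          rw [List.concat_eq_append, ← List.cons_append, ← List.append_assoc] at h
          rw [List.concat_eq_append, (List.append_inj' h rfl).2]
  · rintro ⟨hs, h1, h2, h3⟩
    refine ⟨fun u v j y hy hw => ?_, ?_, (cnt hs w).1 h3⟩
    · rw [List.append_assoc, List.append_eq_append_iff] at hw
      -- The word `u` ends behind the first `s` letters `t`, or among them.
      rcases hw with ⟨a, rfl, ha⟩ | ⟨a, ha, ha'⟩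
      · cases a with
        | nil =>
          simp only [List.nil_append] at ha
          cases j with
          | zero => simp at ha; simp [List.count_replicate]; omega
          | succ j => simp [List.replicate_succ] at ha; exact absurd ha.1 hx
        | cons b a =>
          simp only [List.cons_append, List.cons.injEq] at ha
          obtain ⟨rfl, ha⟩ := ha
          have := h1 a v j y hy (by simp [ha])
          rw [cast hs] at this
          simp only [List.count_append, List.count_replicate, List.count_cons]
          cases x <;> simp_all <;> omega
      · have hu : ∀ z ∈ u, z = Letter.t := fun z hz =>
          List.eq_of_mem_replicate (ha ▸ List.mem_append_left a hz)
        have hat : ∀ z ∈ a, z = Letter.t := fun z hz =>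
          List.eq_of_mem_replicate (ha ▸ List.mem_append_right u hz)
        have haj : a = List.replicate a.length Letter.t := List.eq_replicate_of_mem hat
        have hl : u.length + a.length = s := by
          have := congrArg List.length ha; simpa using this.symm
        -- Two equal words start with `j` and with `a.length` letters `t`, each block followed by a
        -- letter other than `t`.
        have hj : j = a.length := by
          rw [haj] at ha'
          rcases lt_trichotomy j a.length with h | h | h
          · obtain ⟨d, hd⟩ := Nat.exists_eq_add_of_lt h
            rw [hd, add_assoc, List.replicate_add, List.append_assoc, List.append_cancel_left_eq,
              List.replicate_succ] at ha'
            simp at ha'; exact absurd ha'.1 hy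
          · exact h
          · obtain ⟨d, hd⟩ := Nat.exists_eq_add_of_lt h
            rw [hd, add_assoc, List.replicate_add, List.append_assoc, List.append_cancel_left_eq,
              List.replicate_succ] at ha'
            simp at ha'; exact absurd ha'.1.symm hx
        have hm : u.count Letter.m = 0 := List.count_eq_zero.2 fun h => by simpa using hu _ h
        have hf : u.count Letter.f = 0 := List.count_eq_zero.2 fun h => by simpa using hu _ h
        rw [hm, hf]; push_cast; omega
    · right
      rcases h2 with rfl | ⟨u, rfl⟩
      · have : x = Letter.f := by
          cases x <;> simp [slotsAfter] at h3 hx ⊢ <;> omega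
        exact ⟨List.replicate s Letter.t, by simp [this]⟩
      · exact ⟨List.replicate s Letter.t ++ x :: u, by simp⟩

/-- The `s` translations already made are put back as letters `t` in front of the remaining word. -/
theorem canComplete_iff_isCompletion (w : List Letter) (s N : ℕ) :
    CanComplete w s N ↔ IsCompletion N (List.replicate s Letter.t ++ w) := by
  induction w generalizing s N with
  | nil => simp [CanComplete, isCompletion_replicate_t]
  | cons x w ih =>
    by_cases hx : x = Letter.t
    · subst hx
      rw [canComplete_t, ih, List.replicate_succ']
      simp
    · rw [canComplete_cons hx, isCompletion_replicate_t_append hx, ih]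
      simp

theorem isCodeword_iff_canComplete (w : List Letter) : IsCodeword w ↔ CanComplete w 0 1 := by
  rw [isCodeword_iff_isCompletion, canComplete_iff_isCompletion]
  simp

theorem CanComplete.exists_replicate_t {w : List Letter} {s N : ℕ} (h : CanComplete w s N) :
    (w = [] ∧ s = 0 ∧ N = 0) ∨ ∃ j x w', x ≠ Letter.t ∧
      w = List.replicate j Letter.t ++ x :: w' ∧ s + j < N ∧ CanComplete w' 0 (slotsAfter N x) := by
  induction w generalizing s with
  | nil => exact Or.inl ⟨rfl, h.1, h.2⟩
  | cons x w ih =>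
    right
    by_cases hx : x = Letter.t
    · subst hx
      rw [canComplete_t] at h
      rcases ih h with h | ⟨j, y, w', h1, h2, h3, h4⟩
      · omega
      · exact ⟨j + 1, y, w', h1, by simp [h2, List.replicate_succ], by omega, h4⟩
    · rw [canComplete_cons hx] at h
      exact ⟨0, x, w, hx, by simp, by simpa using h.1, h.2⟩

theorem canComplete_replicate_t_append (j : ℕ) (w : List Letter) (s N : ℕ) :
    CanComplete (List.replicate j Letter.t ++ w) s N ↔ CanComplete w (s + j) N := by
  induction j generalizing s with
  | zero => simp
  | succ j ih => rw [List.replicate_succ, List.cons_append, canComplete_t, ih, add_right_comm,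
      ← add_assoc]

/-! ### The entries of the represented permutation -/

theorem count_insertLetters {w : List Letter} {i s : ℕ} {p : List (Option ℕ)}
    (h : CanComplete w s (p.count none)) : (insertLetters w i s p).count none = 0 := by
  induction w generalizing i s p with
  | nil => exact h.2
  | cons x w ih =>
    by_cases hx : x = Letter.t
    · subst hx; exact ih ((canComplete_t _ _ _).1 h)
    · rw [canComplete_cons hx] at h
      rw [insertLetters_cons x hx]
      exact ih (by rw [count_replaceSlot i hx h.1]; exact h.2)

theorem perm_replaceSlot {x : Letter} (hx : x ≠ Letter.t) {i s : ℕ} {p : List (Option ℕ)}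
    (h : s < p.count none) (hp : p.reduceOption.Perm (List.range' 1 i)) :
    (replaceSlot (slotContent (i + 1) x) s p).reduceOption.Perm (List.range' 1 (i + 1)) := by
  obtain ⟨A, B, h1, -, h3⟩ := exists_replaceSlot p s h
  rw [h3, List.reduceOption_append, List.reduceOption_append, reduceOption_slotContent _ hx,
    List.range'_concat]
  rw [h1, List.reduceOption_append, List.reduceOption_cons_of_none] at hp
  have h4 := hp.append_right [i + 1]
  rw [mul_comm, mul_one, add_comm 1 i]
  refine List.Perm.trans ?_ h4
  rw [List.append_assoc]
  exact List.perm_append_comm.append_left _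

theorem perm_insertLetters {w : List Letter} {i s : ℕ} {p : List (Option ℕ)}
    (h : CanComplete w s (p.count none)) (hp : p.reduceOption.Perm (List.range' 1 i)) :
    (insertLetters w (i + 1) s p).reduceOption.Perm
      (List.range' 1 (i + w.countP (· ≠ Letter.t))) := by
  induction w generalizing i s p with
  | nil => exact hp
  | cons x w ih =>
    by_cases hx : x = Letter.t
    · subst hx; simpa [insertLetters] using ih ((canComplete_t _ _ _).1 h) hp
    · rw [canComplete_cons hx] at h
      rw [insertLetters_cons x hx]
      have := ih (i := i + 1) (by rw [count_replaceSlot (i + 1) hx h.1]; exact h.2)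
        (perm_replaceSlot hx h.1 hp)
      rw [List.countP_cons_of_pos (by simpa using hx)]
      have e : ∀ k, i + (k + 1) = i + 1 + k := fun k => by omega
      rw [e (w.countP (· ≠ Letter.t))]
      exact this

theorem IsCodeword.perm_decode_range {w : List Letter} (h : IsCodeword w) :
    (decode w).Perm (List.range' 1 (w.countP (· ≠ Letter.t))) := by
  rw [isCodeword_iff_canComplete] at h
  have := perm_insertLetters (p := [none]) (i := 0) (by simpa using h)
    (by simp [List.reduceOption])
  rwa [zero_add, zero_add] at this

theorem IsCodeword.perm_decode {w : List Letter} (h : IsCodeword w) :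
    (decode w).Perm (List.range' 1 (decode w).length) := by
  have := h.perm_decode_range
  rw [this.length_eq, List.length_range']
  exact this

theorem IsCodeword.nodup_decode {w : List Letter} (h : IsCodeword w) : (decode w).Nodup :=
  h.perm_decode.nodup_iff.2 List.nodup_range'

theorem eq_map_some_of_count_none {p : List (Option ℕ)} (h : p.count none = 0) :
    p = p.reduceOption.map some := by
  induction p with
  | nil => rfl
  | cons o p ih => cases o with
    | none => simp at h
    | some a => simp only [List.reduceOption_cons_of_some, List.map_cons]; rw [← ih (by simpa using h)]

theorem IsCodeword.insertLetters_eq {w : List Letter} (h : IsCodeword w) :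
    insertLetters w 1 0 [none] = (decode w).map some :=
  eq_map_some_of_count_none
    (count_insertLetters (by simpa using (isCodeword_iff_canComplete w).1 h))

/-! ### Codewords and permutations -/

/-- Put an open slot in front of a partially built permutation, unless there is one already. -/
def consSlot : List (Option ℕ) → List (Option ℕ)
  | none :: p => none :: p
  | p => none :: p

/-- Replace each maximal run of slots and entries `≥ i` by a single slot. -/
def collapse (i : ℕ) : List (Option ℕ) → List (Option ℕ)
  | [] => []
  | none :: p => consSlot (collapse i p)
  | some a :: p => if a < i then some a :: collapse i p else consSlot (collapse i p)

/-- No two slots are adjacent. -/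
def SlotsApart (p : List (Option ℕ)) : Prop :=
  p.IsChain fun a b => a ≠ none ∨ b ≠ none

theorem consSlot_idem (p : List (Option ℕ)) : consSlot (consSlot p) = consSlot p := by
  cases p with
  | nil => rfl
  | cons o p => cases o <;> rfl

theorem consSlot_eq_cons {p : List (Option ℕ)} (h : SlotsApart (none :: p)) :
    consSlot p = none :: p := by
  cases p with
  | nil => rfl
  | cons o p => cases o with
    | none => simp [SlotsApart] at h
    | some a => rfl

theorem collapse_none_cons (i : ℕ) (p : List (Option ℕ)) :
    collapse i (none :: p) = consSlot (collapse i p) := by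
  simp [collapse]

theorem collapse_consSlot (i : ℕ) (p : List (Option ℕ)) :
    collapse i (consSlot p) = consSlot (collapse i p) := by
  cases p with
  | nil => rfl
  | cons o p => cases o with
    | none => rw [show consSlot (none :: p) = none :: p from rfl, collapse_none_cons, consSlot_idem]
    | some a => simp only [consSlot, collapse_none_cons]

/-- A lower threshold absorbs the slots made by the higher one, so the forms of a permutation at all
thresholds are obtained by successive collapsing. -/
theorem collapse_collapse (i : ℕ) (p : List (Option ℕ)) :
    collapse i (collapse (i + 1) p) = collapse i p := by
  induction p with
  | nil => rfl
  | cons o p ih =>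
    cases o with
    | none => simp only [collapse, collapse_consSlot, ih]
    | some a =>
      rcases lt_trichotomy a i with h | h | h
      · simp [collapse, h, h.trans (Nat.lt_succ_self i), ih]
      · simp [collapse, h, ih]
      · have h1 : ¬ a < i := by omega
        have h2 : ¬ a < i + 1 := by omega
        simp only [collapse, h1, h2, if_false, collapse_consSlot, ih]

theorem collapse_append_congr (i : ℕ) (A : List (Option ℕ)) {X Y : List (Option ℕ)}
    (h : collapse i X = collapse i Y) : collapse i (A ++ X) = collapse i (A ++ Y) := by
  induction A with
  | nil => exact h
  | cons o A ih => cases o <;> simp [collapse, ih]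

theorem collapse_eq_self {i : ℕ} {p : List (Option ℕ)} (h : SlotsApart p)
    (hi : ∀ a, some a ∈ p → a < i) : collapse i p = p := by
  induction p with
  | nil => rfl
  | cons o p ih =>
    have h' : SlotsApart p := List.IsChain.tail h
    have := ih h' fun a ha => hi a (List.mem_cons_of_mem _ ha)
    cases o with
    | none => rw [collapse_none_cons, this, consSlot_eq_cons h]
    | some a => simp [collapse, hi a (by simp), this]

theorem slotsApart_consSlot {p : List (Option ℕ)} (h : SlotsApart p) : SlotsApart (consSlot p) := by
  cases p with
  | nil => simp [consSlot, SlotsApart]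
  | cons o p => cases o with
    | none => exact h
    | some a =>
      simp only [consSlot, SlotsApart, List.isChain_cons_cons]
      exact ⟨Or.inr (by simp), h⟩

theorem slotsApart_collapse (i : ℕ) (p : List (Option ℕ)) : SlotsApart (collapse i p) := by
  induction p with
  | nil => simp [collapse, SlotsApart]
  | cons o p ih =>
    cases o with
    | none => rw [collapse_none_cons]; exact slotsApart_consSlot ih
    | some a =>
      simp only [collapse]
      split_ifs
      · exact List.isChain_cons.2 ⟨fun _ _ => Or.inl (by simp), ih⟩
      · exact slotsApart_consSlot ih

theorem reduceOption_consSlot (p : List (Option ℕ)) :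
    (consSlot p).reduceOption = p.reduceOption := by
  cases p with
  | nil => rfl
  | cons o p => cases o <;> simp [consSlot, List.reduceOption]

theorem reduceOption_collapse (i : ℕ) (p : List (Option ℕ)) :
    (collapse i p).reduceOption = p.reduceOption.filter (· < i) := by
  induction p with
  | nil => rfl
  | cons o p ih =>
    cases o with
    | none => rw [collapse_none_cons, reduceOption_consSlot, ih, List.reduceOption_cons_of_none]
    | some a =>
      by_cases h : a < i <;>
        simp [collapse, h, List.reduceOption_cons_of_some, reduceOption_consSlot, ih]

/-- Filling a slot between entries can be undone by collapsing. -/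
theorem collapse_append_slotContent {i : ℕ} {A B : List (Option ℕ)} (x : Letter)
    (h : SlotsApart (A ++ none :: B)) (hi : ∀ a, some a ∈ A ++ none :: B → a < i) :
    collapse i (A ++ (slotContent i x ++ B)) = A ++ none :: B := by
  rw [← collapse_eq_self h hi]
  apply collapse_append_congr
  cases x <;> simp [slotContent, collapse, consSlot_idem]

/-- Each slot that remains is separated from the other by the new entry, and its outer neighbour is
that of the old slot. -/
theorem SlotsApart.append_slotContent {i : ℕ} {A B : List (Option ℕ)} (x : Letter)
    (h : SlotsApart (A ++ none :: B)) : SlotsApart (A ++ (slotContent i x ++ B)) := by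
  unfold SlotsApart at *
  cases x <;> simp_all [slotContent, List.isChain_append, List.isChain_cons]

/-- The partially built permutations in a run are determined by the result of the run. -/
theorem eq_collapse_of_canComplete {w : List Letter} {i s : ℕ} {p : List (Option ℕ)}
    (h : CanComplete w s (p.count none)) (hp : SlotsApart p) (hi : ∀ a, some a ∈ p → a < i) :
    p = collapse i (insertLetters w i s p) := by
  induction w generalizing i s p with
  | nil => exact (collapse_eq_self hp hi).symm
  | cons x w ih =>
    by_cases hx : x = Letter.t
    · subst hx; exact ih ((canComplete_t _ _ _).1 h) hp hi
    · rw [canComplete_cons hx] at h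
      rw [insertLetters_cons x hx]
      obtain ⟨A, B, h1, -, h3⟩ := exists_replaceSlot p s h.1
      subst h1
      have := ih (i := i + 1) (s := 0) (p := replaceSlot (slotContent i x) s (A ++ none :: B))
        (by rw [count_replaceSlot i hx h.1]; exact h.2)
        (by rw [h3]; exact hp.append_slotContent x)
        (fun a ha => by
          rw [h3] at ha
          simp only [List.mem_append] at ha
          rcases ha with ha | ha | ha
          · exact (hi a (by simp [ha])).trans (Nat.lt_succ_self i)
          · cases x <;> simp_all [slotContent]
          · exact (hi a (by simp [ha])).trans (Nat.lt_succ_self i))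
      -- At threshold `i + 1` the final list collapses to the state after the letter; threshold `i`
      -- then restores the filled slot.
      rw [← collapse_collapse, ← this, h3, collapse_append_slotContent x hp hi]

/-- The part of `slotContent` to the left of the new entry. -/
def slotLeft : Letter → List (Option ℕ)
  | Letter.r => [none]
  | Letter.m => [none]
  | _ => []

/-- The part of `slotContent` to the right of the new entry. -/
def slotRight : Letter → List (Option ℕ)
  | Letter.l => [none]
  | Letter.m => [none]
  | _ => []

theorem slotContent_eq (i : ℕ) {x : Letter} (hx : x ≠ Letter.t) :
    slotContent i x = slotLeft x ++ some i :: slotRight x := by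
  cases x <;> simp_all [slotContent, slotLeft, slotRight]

theorem slotLeft_eq (x : Letter) : slotLeft x = [] ∨ slotLeft x = [none] := by
  cases x <;> simp [slotLeft]

theorem slotRight_eq (x : Letter) : slotRight x = [] ∨ slotRight x = [none] := by
  cases x <;> simp [slotRight]

theorem eq_of_slotLeft_eq_of_slotRight_eq {x y : Letter} (hx : x ≠ Letter.t) (hy : y ≠ Letter.t)
    (h1 : slotLeft x = slotLeft y) (h2 : slotRight x = slotRight y) : x = y := by
  cases x <;> cases y <;> simp_all [slotLeft, slotRight]

/-! ### Uniqueness of the codeword. -/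

theorem append_none_ne {A A' B : List (Option ℕ)} (h : SlotsApart (A ++ none :: B)) :
    A ≠ A' ++ [none] := by
  rintro rfl
  simp [SlotsApart, List.isChain_append] at h

theorem ne_cons_none {A B B' : List (Option ℕ)} (h : SlotsApart (A ++ none :: B)) :
    B ≠ none :: B' := by
  rintro rfl
  simp [SlotsApart, List.isChain_append] at h

/-- A filled slot and its content can be recovered. -/
theorem slot_unique {i : ℕ} {A B A' B' : List (Option ℕ)} {x y : Letter} (hx : x ≠ Letter.t)
    (hy : y ≠ Letter.t) (h : SlotsApart (A ++ none :: B)) (h' : SlotsApart (A' ++ none :: B'))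
    (hi : some i ∉ A ++ none :: B)
    (he : A ++ (slotContent i x ++ B) = A' ++ (slotContent i y ++ B')) : A = A' ∧ x = y := by
  rw [slotContent_eq i hx, slotContent_eq i hy] at he
  have he' : (A ++ slotLeft x) ++ some i :: (slotRight x ++ B) =
      (A' ++ slotLeft y) ++ some i :: (slotRight y ++ B') := by simpa using he
  have n1 : some i ∉ A ++ slotLeft x := by
    rcases slotLeft_eq x with h | h <;> simp_all
  have n2 : some i ∉ slotRight x ++ B := by
    rcases slotRight_eq x with h | h <;> simp_all
  obtain ⟨e1, -, e2⟩ := (List.append_cons_inj_of_notMem n1 n2).1 he'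
  -- If only one of the letters left a slot beside the new entry, that slot would have to belong to
  -- the surrounding list of the other, where it would be adjacent to the filled slot.
  have l : slotLeft x = slotLeft y := by
    rcases slotLeft_eq x with hl | hl <;> rcases slotLeft_eq y with hl' | hl' <;>
      rw [hl, hl'] at e1 ⊢
    · rw [List.append_nil] at e1; exact absurd e1 (append_none_ne h)
    · rw [List.append_nil] at e1; exact absurd e1.symm (append_none_ne h')
  have r : slotRight x = slotRight y := by
    rcases slotRight_eq x with hl | hl <;> rcases slotRight_eq y with hl' | hl' <;>
      rw [hl, hl'] at e2 ⊢
    · exact absurd e2 (ne_cons_none h)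
    · exact absurd e2.symm (ne_cons_none h')
  rw [l] at e1
  exact ⟨List.append_cancel_right e1, eq_of_slotLeft_eq_of_slotRight_eq hx hy l r⟩

/-- After the first insertion of either word, `eq_collapse_of_canComplete` recovers the state from
the common result, so the two states agree; `slot_unique` then identifies slot and letter. The
induction is strong because a whole block of letters `t` and its letter are removed at once. -/
theorem canComplete_unique {w w' : List Letter} {i : ℕ} {p : List (Option ℕ)}
    (h : CanComplete w 0 (p.count none)) (h' : CanComplete w' 0 (p.count none))
    (hp : SlotsApart p) (hi : ∀ a, some a ∈ p → a < i)
    (he : insertLetters w i 0 p = insertLetters w' i 0 p) : w = w' := by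
  induction hn : w.length using Nat.strong_induction_on generalizing w w' i p with
  | _ n ih =>
  rcases h.exists_replicate_t with ⟨rfl, -, h0⟩ | ⟨j, x, v, hx, rfl, hj, hv⟩
  · rcases h'.exists_replicate_t with ⟨rfl, -⟩ | ⟨j, y, v', hy, rfl, hj', hv'⟩
    · rfl
    · omega
  rcases h'.exists_replicate_t with ⟨rfl, -, h0⟩ | ⟨j', y, v', hy, rfl, hj', hv'⟩
  · omega
  rw [zero_add] at hj hj'
  rw [insertLetters_replicate_t, insertLetters_replicate_t, insertLetters_cons x hx,
    insertLetters_cons y hy, zero_add, zero_add] at he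
  obtain ⟨A, B, h1, h2, h3⟩ := exists_replaceSlot p j hj
  obtain ⟨A', B', h1', h2', h3'⟩ := exists_replaceSlot p j' hj'
  have key : ∀ {A B : List (Option ℕ)} {x : Letter}, x ≠ Letter.t → p = A ++ none :: B →
      SlotsApart (A ++ (slotContent i x ++ B)) ∧
      ∀ a, some a ∈ A ++ (slotContent i x ++ B) → a < i + 1 := by
    intro A B x hx hAB
    refine ⟨(hAB ▸ hp).append_slotContent x, fun a ha => ?_⟩
    simp only [List.mem_append] at ha
    rcases ha with ha | ha | ha
    · exact (hi a (by simp [hAB, ha])).trans (Nat.lt_succ_self i)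
    · cases x <;> simp_all [slotContent]
    · exact (hi a (by simp [hAB, ha])).trans (Nat.lt_succ_self i)
  obtain ⟨k1, k2⟩ := key hx h1
  obtain ⟨k1', k2'⟩ := key hy h1'
  have c1 := count_replaceSlot i hx hj
  have c2 := count_replaceSlot i hy hj'
  rw [h3] at he c1
  rw [h3'] at he c2
  rw [← c1] at hv
  rw [← c2] at hv'
  have E1 := eq_collapse_of_canComplete hv k1 k2
  have E2 := eq_collapse_of_canComplete hv' k1' k2'
  rw [he, ← E2] at E1
  obtain ⟨hA, rfl⟩ := slot_unique hx hy (h1 ▸ hp) (h1' ▸ hp)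
    (fun hmem => absurd (hi i (h1 ▸ hmem)) (lt_irrefl i)) E1
  have hjj : j = j' := by rw [← h2, ← h2', hA]
  subst hjj
  congr 2
  refine ih v.length (by simp [← hn]; omega) hv (by rw [E1]; exact hv') k1 k2 ?_ rfl
  rw [he, E1]

theorem injOn_decode : Set.InjOn decode {w | IsCodeword w} := by
  intro w hw w' hw' he
  refine canComplete_unique (i := 1) (p := [none])
    (by simpa using (isCodeword_iff_canComplete w).1 hw)
    (by simpa using (isCodeword_iff_canComplete w').1 hw') (by simp [SlotsApart]) (by simp) ?_
  rw [IsCodeword.insertLetters_eq hw, IsCodeword.insertLetters_eq hw', he]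

/-! ### Existence of a codeword for every permutation. -/

theorem exists_eq_append_slot {i : ℕ} {U V : List (Option ℕ)} (h : SlotsApart (U ++ some i :: V)) :
    ∃ A B x, x ≠ Letter.t ∧ U ++ some i :: V = A ++ (slotContent i x ++ B) ∧
      SlotsApart (A ++ none :: B) ∧
      ∀ a, some a ∈ A ++ none :: B → some a ∈ U ∨ some a ∈ V := by
  have hU : (∃ A, U = A ++ [none]) ∨ ∀ y ∈ U.getLast?, y ≠ none := by
    rcases List.eq_nil_or_concat U with rfl | ⟨U', o, rfl⟩
    · simp
    · cases o <;> simp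
  have hV : (∃ B, V = none :: B) ∨ ∀ y ∈ V.head?, y ≠ none := by
    cases V with
    | nil => simp
    | cons o V => cases o <;> simp
  unfold SlotsApart at *
  -- Slots on both sides of `i`, only on its left, only on its right, and on neither side correspond
  -- to `m`, `r`, `l`, `f`.
  rcases hU with ⟨A, rfl⟩ | hU <;> rcases hV with ⟨B, rfl⟩ | hV
  · refine ⟨A, B, Letter.m, by simp, by simp [slotContent], ?_, by simp⟩
    simp_all [List.isChain_append, List.isChain_cons]
  · refine ⟨A, V, Letter.r, by simp, by simp [slotContent], ?_, by simp⟩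
    simp_all [List.isChain_append, List.isChain_cons]
  · refine ⟨U, B, Letter.l, by simp, by simp [slotContent], ?_, by simp⟩
    simp_all [List.isChain_append, List.isChain_cons]
  · refine ⟨U, V, Letter.f, by simp, by simp [slotContent], ?_, by simp⟩
    simp_all [List.isChain_append, List.isChain_cons]

/-- Downward induction on `i`. At `n + 1` nothing collapses and the empty word works. To pass from
`i + 1` to `i`, the largest visible entry `i` is removed together with its adjacent slots; the
letter found by `exists_eq_append_slot` puts it back. -/
theorem exists_canComplete {r : List ℕ} {n : ℕ} (hr : r.Perm (List.range' 1 n)) {i : ℕ}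
    (h1 : 1 ≤ i) (hi : i ≤ n + 1) :
    ∃ w, CanComplete w 0 ((collapse i (r.map some)).count none) ∧
      insertLetters w i 0 (collapse i (r.map some)) = r.map some := by
  have hr' : ∀ a, a ∈ r ↔ 1 ≤ a ∧ a < 1 + n := fun a => by rw [hr.mem_iff, List.mem_range'_1]
  have hnd : r.Nodup := hr.nodup_iff.2 List.nodup_range'
  have hred : (r.map some).reduceOption = r := by
    simp [List.reduceOption, List.filterMap_map]
  induction hi using Nat.decreasingInduction with
  | self =>
    have : collapse (n + 1) (r.map some) = r.map some := by
      apply collapse_eq_self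
      · have : ∀ l : List ℕ, SlotsApart (l.map some) := fun l => by
          induction l with
          | nil => simp [SlotsApart]
          | cons a l ih => exact List.isChain_cons.2 ⟨fun _ _ => Or.inl (by simp), ih⟩
        exact this r
      · intro a ha
        have := (hr' a).1 (by simpa using ha)
        omega
    rw [this]
    exact ⟨[], by simp [CanComplete, List.count_eq_zero], rfl⟩
  | of_succ i hi ih =>
    obtain ⟨w, hw1, hw2⟩ := ih (by omega)
    set q := collapse (i + 1) (r.map some) with hq
    have hq1 : SlotsApart q := slotsApart_collapse _ _
    have hq2 : q.reduceOption = r.filter (· < i + 1) := by rw [hq, reduceOption_collapse, hred]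
    have hmem : some i ∈ q := by
      rw [← List.reduceOption_mem_iff, hq2]
      simp [hr']; omega
    obtain ⟨U, V, hUV⟩ := List.append_of_mem hmem
    have hq3 : (U.reduceOption ++ i :: V.reduceOption).Nodup := by
      have : q.reduceOption.Nodup := by rw [hq2]; exact hnd.filter _
      simpa [hUV, List.reduceOption_append, List.reduceOption_cons_of_some] using this
    -- The entries of `q` are less than `i + 1`, and `i` occurs only once.
    have hlt : ∀ a, some a ∈ U ∨ some a ∈ V → a < i := by
      intro a ha
      have h1 : a ∈ q.reduceOption := by
        rw [List.reduceOption_mem_iff, hUV]; simp; tauto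
      rw [hq2] at h1
      have h2 : a ≠ i := by
        rintro rfl
        rw [List.nodup_append, List.nodup_cons] at hq3
        rcases ha with ha | ha
        · exact hq3.2.2 a (List.reduceOption_mem_iff.2 ha) a (by simp) rfl
        · exact hq3.2.1.1 (List.reduceOption_mem_iff.2 ha)
      simp at h1; omega
    obtain ⟨A, B, x, hx, e1, e2, e3⟩ := exists_eq_append_slot (hUV ▸ hq1)
    have hp : collapse i (r.map some) = A ++ none :: B := by
      rw [← collapse_collapse, ← hq, hUV, e1]
      exact collapse_append_slotContent x e2 fun a ha => hlt a (e3 a ha)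
    have hrep : replaceSlot (slotContent i x) (A.count none) (A ++ none :: B) = q := by
      rw [replaceSlot_append, hUV, e1]
    have hcnt : A.count none < (A ++ none :: B).count none := by simp
    refine ⟨List.replicate (A.count none) Letter.t ++ x :: w, ?_, ?_⟩
    · rw [canComplete_replicate_t_append, canComplete_cons hx, hp, zero_add]
      refine ⟨hcnt, ?_⟩
      rw [← count_replaceSlot i hx hcnt, hrep]
      exact hw1
    · rw [insertLetters_replicate_t, insertLetters_cons x hx, zero_add, hp, hrep, hw2]

/-- At threshold `1` a nonempty permutation collapses to the single initial slot. -/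
theorem exists_isCodeword_decode_eq {r : List ℕ} (h : r ≠ [])
    (hr : r.Perm (List.range' 1 r.length)) : ∃ w, IsCodeword w ∧ decode w = r := by
  have h1 : collapse 1 (r.map some) = [none] := by
    have : ∀ l : List ℕ, l ≠ [] → (∀ a ∈ l, 1 ≤ a) → collapse 1 (l.map some) = [none] := by
      intro l
      induction l with
      | nil => simp
      | cons a l ih =>
        intro _ h
        have ha : ¬ a < 1 := by have := h a (by simp); omega
        simp only [List.map_cons, collapse, ha, if_false]
        by_cases hl : l = []
        · subst hl; rfl
        · rw [ih hl fun b hb => h b (by simp [hb])]; rfl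
    refine this r h fun a ha => ?_
    rw [hr.mem_iff, List.mem_range'_1] at ha
    exact ha.1
  obtain ⟨w, hw1, hw2⟩ := exists_canComplete hr le_rfl (by omega)
  rw [h1] at hw1 hw2
  refine ⟨w, (isCodeword_iff_canComplete w).2 (by simpa using hw1), ?_⟩
  rw [decode, hw2]
  simp [List.reduceOption, List.filterMap_map]

/-- The initial slot is recovered by collapsing the result, and an empty list collapses to no slot.
-/
theorem IsCodeword.decode_ne_nil {w : List Letter} (h : IsCodeword w) : decode w ≠ [] := by
  intro h0
  have := eq_collapse_of_canComplete (i := 1) (s := 0) (p := [none]) (w := w)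
    (by simpa using (isCodeword_iff_canComplete w).1 h) (by simp [SlotsApart]) (by simp)
  rw [h.insertLetters_eq, h0] at this
  simp [collapse] at this

theorem bijOn_decode (B : List (List ℝ)) :
    Set.BijOn decode (codewordsAvoidingAll B) (avoidanceClass B) := by
  refine ⟨fun w hw => ⟨IsCodeword.decode_ne_nil hw.1, IsCodeword.perm_decode hw.1, hw.2⟩,
    injOn_decode.mono fun w hw => hw.1, fun r hr => ?_⟩
  obtain ⟨w, hw, rfl⟩ := exists_isCodeword_decode_eq hr.1 hr.2.1
  exact ⟨w, ⟨hw, hr.2.2⟩, rfl⟩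

/-! ### Deterministic computations inside a fixed part of the tape -/

namespace NTM

variable {A : Type}

/-- At most one transition applies to each state and symbol. -/
def IsDeterministic (M : NTM A) : Prop :=
  ∀ s a x y, x ∈ M.trans s a → y ∈ M.trans s a → x = y

/-- The head is on one of the squares `0, …, n`. -/
def Config.Within {M : NTM A} (n : ℕ) (c : M.Config) : Prop :=
  0 ≤ c.head ∧ c.head ≤ n

/-- `StepsTo`, with the head always on one of the squares `0, …, n`. -/
def StepsWithin (M : NTM A) (n : ℕ) : ℕ → M.Config → M.Config → Prop
  | 0, c, d => c = d ∧ c.Within n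
  | k + 1, c, d => c.Within n ∧ ∃ e, M.Step c e ∧ M.StepsWithin n k e d

variable {M : NTM A} {n : ℕ}

theorem StepsWithin.trans {k l : ℕ} {c d e : M.Config} (h : M.StepsWithin n k c d)
    (h' : M.StepsWithin n l d e) : M.StepsWithin n (k + l) c e := by
  induction k generalizing c with
  | zero => obtain ⟨rfl, -⟩ := h; simpa using h'
  | succ k ih =>
    obtain ⟨h1, f, h2, h3⟩ := h
    rw [Nat.add_right_comm]
    exact ⟨h1, f, h2, ih h3⟩

theorem StepsWithin.single {c d : M.Config} (h : M.Step c d) (hc : c.Within n) (hd : d.Within n) :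
    M.StepsWithin n 1 c d :=
  ⟨hc, d, h, rfl, hd⟩

theorem StepsWithin.stepsTo {k : ℕ} {c d : M.Config} (h : M.StepsWithin n k c d) :
    M.StepsTo k c d := by
  induction k generalizing c with
  | zero => exact h.1
  | succ k ih => obtain ⟨-, e, h1, h2⟩ := h; exact ⟨e, h1, ih h2⟩

theorem StepsWithin.within_left {k : ℕ} {c d : M.Config} (h : M.StepsWithin n k c d) :
    c.Within n := by
  cases k with
  | zero => exact h.2
  | succ k => exact h.1

theorem IsDeterministic.step_unique (hM : M.IsDeterministic) {c d e : M.Config}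
    (h : M.Step c d) (h' : M.Step c e) : d = e := by
  obtain ⟨q, a, v, h1, rfl⟩ := h
  obtain ⟨q', a', v', h1', rfl⟩ := h'
  have := hM _ _ _ _ h1 h1'
  simp only [Prod.mk.injEq] at this
  obtain ⟨rfl, rfl, rfl⟩ := this
  rfl

/-- Every computation is an initial part of the given one. Hence one halting run inside the allowed
squares bounds time and space and fixes the outcome for all runs. -/
theorem IsDeterministic.stepsTo_of_halts (hM : M.IsDeterministic) {k : ℕ} {c e : M.Config}
    (h : M.StepsWithin n k c e) (he : ∀ d, ¬ M.Step e d) {j : ℕ} {d : M.Config}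
    (hd : M.StepsTo j c d) : j ≤ k ∧ d.Within n ∧ ((∀ d', ¬ M.Step d d') → d = e) := by
  induction j generalizing c k with
  | zero =>
    obtain rfl : c = d := hd
    refine ⟨Nat.zero_le _, h.within_left, fun hc => ?_⟩
    cases k with
    | zero => exact h.1
    | succ k => obtain ⟨-, f, h1, -⟩ := h; exact absurd h1 (hc f)
  | succ j ih =>
    obtain ⟨f, h1, h2⟩ := hd
    cases k with
    | zero => obtain ⟨rfl, -⟩ := h; exact absurd h1 (he f)
    | succ k =>
      obtain ⟨-, f', h1', h2'⟩ := h
      obtain rfl := hM.step_unique h1 h1'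
      obtain ⟨h3, h4, h5⟩ := ih h2' h2
      exact ⟨by omega, h4, h5⟩

end NTM

/-! ### Bounded counter machines -/

/-- How a counter is computed from the previous values of all counters. -/
inductive CounterOp (J : Type)
  | zero
  | one
  | copy (j : J)
  | succ (j : J)
  | pred (j : J)

namespace CounterOp

variable {J : Type}

/-- The new value of the counter; counters do not exceed `n`. -/
def apply (n : ℕ) (v : J → ℕ) : CounterOp J → ℕ
  | zero => 0
  | one => min n 1
  | copy j => v j
  | succ j => min n (v j + 1)
  | pred j => v j - 1

/-- The new value of the counter before a final increment. -/
def base (v : J → ℕ) : CounterOp J → ℕ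
  | zero => 0
  | one => 0
  | copy j => v j
  | succ j => v j
  | pred j => v j - 1

/-- Whether there is a final increment. -/
def Raises : CounterOp J → Prop
  | one => True
  | succ _ => True
  | _ => False

open Classical in
-- This splits an operation between the two sweeps: a left sweep computes `base`, and the following
-- right sweep performs the increment.
theorem apply_eq (n : ℕ) (v : J → ℕ) (o : CounterOp J) :
    o.apply n v = if o.Raises then min n (o.base v + 1) else o.base v := by
  cases o <;> simp [apply, base, Raises]

theorem apply_le {n : ℕ} {v : J → ℕ} (h : ∀ j, v j ≤ n) (o : CounterOp J) : o.apply n v ≤ n := by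
  cases o <;> simp [apply, h]
  · exact (h _).trans (Nat.le_succ n)

end CounterOp

/-- A deterministic machine with counters `j : J` whose values lie between `0` and the length of
the input `w`. A transition depends on the view: the set of all columns
`(w_z, {j | z < value of j})`, `z < |w|`. -/
structure CounterMachine (A J : Type) where
  State : Type
  finiteState : Finite State
  start : State
  accept : Set State
  trans : State → Set (A × (J → Prop)) → Option (State × (J → CounterOp J))

namespace CounterMachine

variable {A J : Type}

/-- The columns `(w_z, {j | z < v j})` with `z < h`. -/
def viewTo (w : List A) (v : J → ℕ) (h : ℕ) : Set (A × (J → Prop)) :=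
  {γ | ∃ z a, z < h ∧ w[z]? = some a ∧ γ = (a, fun j => z < v j)}

/-- All columns. -/
def view (w : List A) (v : J → ℕ) : Set (A × (J → Prop)) :=
  viewTo w v w.length

/-- One step on the input `w`. -/
def next (M : CounterMachine A J) (w : List A) (c : M.State × (J → ℕ)) :
    Option (M.State × (J → ℕ)) :=
  (M.trans c.1 (view w c.2)).map fun x => (x.1, fun j => (x.2 j).apply w.length c.2)

/-- Exactly `k` steps on the input `w`. -/
def Runs (M : CounterMachine A J) (w : List A) :
    ℕ → M.State × (J → ℕ) → M.State × (J → ℕ) → Prop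
  | 0, c, d => c = d
  | k + 1, c, d => ∃ e, M.next w c = some e ∧ M.Runs w k e d

theorem Runs.trans {M : CounterMachine A J} {w : List A} {k l : ℕ} {c d e : M.State × (J → ℕ)}
    (h : M.Runs w k c d) (h' : M.Runs w l d e) : M.Runs w (k + l) c e := by
  induction k generalizing c with
  | zero => obtain rfl : c = d := h; simpa using h'
  | succ k ih =>
    obtain ⟨f, h2, h3⟩ := h
    rw [Nat.add_right_comm]
    exact ⟨f, h2, ih h3⟩

theorem Runs.single {M : CounterMachine A J} {w : List A} {c d : M.State × (J → ℕ)}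
    (h : M.next w c = some d) : M.Runs w 1 c d :=
  ⟨d, h, rfl⟩

/-! ### Simulation of counter machines by Turing machines -/

/-- The states of the simulating machine: it sweeps to the right to complete pending increments
and to collect the view, and to the left to carry out the other operations. -/
inductive SweepState (Q A J : Type)
  | init
  | right (q : Q) (raise : J → Prop) (prev : J → Prop) (S : Set (A × (J → Prop)))
  | left (q : Q) (act : J → CounterOp J) (next : J → Prop)
  | done

theorem finite_counterOp [Finite J] : Finite (CounterOp J) := by
  refine Finite.of_surjective (α := Option (Option (J ⊕ J ⊕ J))) (fun
    | none => CounterOp.zero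
    | some none => CounterOp.one
    | some (some (Sum.inl j)) => CounterOp.copy j
    | some (some (Sum.inr (Sum.inl j))) => CounterOp.succ j
    | some (some (Sum.inr (Sum.inr j))) => CounterOp.pred j) ?_
  intro o
  cases o with
  | zero => exact ⟨none, rfl⟩
  | one => exact ⟨some none, rfl⟩
  | copy j => exact ⟨some (some (Sum.inl j)), rfl⟩
  | succ j => exact ⟨some (some (Sum.inr (Sum.inl j))), rfl⟩
  | pred j => exact ⟨some (some (Sum.inr (Sum.inr j))), rfl⟩

theorem finite_sweepState {Q : Type} [Finite Q] [Finite A] [Finite J] :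
    Finite (SweepState Q A J) := by
  have := finite_counterOp (J := J)
  refine Finite.of_surjective (α := Option (Option ((Q × (J → Prop) × (J → Prop) ×
    Set (A × (J → Prop))) ⊕ (Q × (J → CounterOp J) × (J → Prop))))) (fun
    | none => SweepState.init
    | some none => SweepState.done
    | some (some (Sum.inl (q, r, p, S))) => SweepState.right q r p S
    | some (some (Sum.inr (q, a, p))) => SweepState.left q a p) ?_
  intro o
  cases o with
  | init => exact ⟨none, rfl⟩
  | done => exact ⟨some none, rfl⟩
  | right q r p S => exact ⟨some (some (Sum.inl (q, r, p, S))), rfl⟩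
  | left q a p => exact ⟨some (some (Sum.inr (q, a, p))), rfl⟩

/-- The tracks after the left sweep, before pending increments. -/
def baseColumn (act : J → CounterOp J) (τ next : J → Prop) (j : J) : Prop :=
  match act j with
  | CounterOp.zero => False
  | CounterOp.one => False
  | CounterOp.copy i => τ i
  | CounterOp.succ i => τ i
  | CounterOp.pred i => next i

open Classical in
/-- The transitions of the simulating machine. A symbol consists of an input letter, of the tracks
of the counters, and of a mark on the leftmost square. -/
noncomputable def sweep (M : CounterMachine A J) :
    SweepState M.State A J → Option (A × (J → Prop) × Prop) →
      Option (SweepState M.State A J × Option (A × (J → Prop) × Prop) × HeadMove)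
  | .init, some (a, τ, _) =>
    some (.right M.start (fun _ => False) (fun _ => True) ∅, some (a, τ, True), .stay)
  | .right q r p S, some (a, τ, b) =>
    let τ' : J → Prop := fun j => if r j then p j else τ j
    some (.right q r τ (insert (a, τ') S), some (a, τ', b), .right)
  | .right q _ _ S, none =>
    match M.trans q S with
    | none => if q ∈ M.accept then some (.done, none, .stay) else none
    | some (q', act) => some (.left q' act (fun _ => False), none, .left)
  | .left q act p, some (a, τ, b) =>
    if b then
      some (.right q (fun j => (act j).Raises) (fun _ => True) ∅,
        some (a, baseColumn act τ p, b), .stay)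
    else some (.left q act τ, some (a, baseColumn act τ p, b), .left)
  | _, _ => none

/-- The simulating machine. -/
noncomputable abbrev toNTM [Finite A] [Finite J] (M : CounterMachine A J) : NTM A where
  State := SweepState M.State A J
  Sym := A × (J → Prop) × Prop
  finiteState := by have := M.finiteState; exact finite_sweepState
  finiteSym := inferInstance
  input := ⟨fun a => (a, fun _ => False, False), fun _ _ h => congrArg Prod.fst h⟩
  start := .init
  accept := {.done}
  trans := fun s a => {x | sweep M s a = some x}

/-- The tape that holds at each square `z < |w|` the column of the counter values `V z`. -/
def tape (w : List A) (V : ℕ → J → ℕ) : ℤ → Option (A × (J → Prop) × Prop) := fun z =>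
  if 0 ≤ z then (w[z.toNat]?).map fun a => (a, (fun j => z.toNat < V z.toNat j), z.toNat = 0)
  else none

theorem tape_natCast (w : List A) (V : ℕ → J → ℕ) (h : ℕ) :
    tape w V h = (w[h]?).map fun a => (a, (fun j => h < V h j), h = 0) := by
  simp [tape]

theorem tape_congr (w : List A) {V V' : ℕ → J → ℕ}
    (h : ∀ z < w.length, V z = V' z) : tape w V = tape w V' := by
  funext z
  unfold tape
  split_ifs with hz
  · by_cases hw : z.toNat < w.length
    · rw [h _ hw]
    · rw [List.getElem?_eq_none (by omega)]; rfl
  · rfl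

/-- The values `V` depend on the square because during a sweep the squares already passed hold other
values than those still to come. -/
theorem update_tape (w : List A) {V V' : ℕ → J → ℕ} {h : ℕ} {a : A} (ha : w[h]? = some a)
    (hV : ∀ z, z ≠ h → V z = V' z) {τ : J → Prop} (hτ : ∀ j, τ j ↔ h < V' h j) :
    Function.update (tape w V) (h : ℤ) (some (a, τ, h = 0)) = tape w V' := by
  funext z
  by_cases hz : z = h
  · subst hz
    rw [Function.update_self, tape_natCast, ha]
    have : τ = fun j => h < V' h j := funext fun j => propext (hτ j)
    simp [this]
  · rw [Function.update_of_ne hz]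
    unfold tape
    split_ifs with h0
    · rw [hV z.toNat (by omega)]
    · rfl

theorem update_tape_none (w : List A) (V : ℕ → J → ℕ) :
    Function.update (tape w V) (w.length : ℤ) none = tape w V := by
  apply Function.update_eq_self_iff.2
  rw [tape_natCast]; simp

theorem viewTo_succ (w : List A) (v : J → ℕ) (h : ℕ) {a : A} (ha : w[h]? = some a) :
    viewTo w v (h + 1) = insert (a, fun j => h < v j) (viewTo w v h) := by
  ext γ
  simp only [viewTo, Set.mem_ofPred_eq, Set.mem_insert_iff]
  constructor
  · rintro ⟨z, b, hz, hb, rfl⟩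
    rcases Nat.lt_succ_iff_lt_or_eq.1 hz with hz | rfl
    · exact Or.inr ⟨z, b, hz, hb, rfl⟩
    · rw [ha] at hb; left; rw [Option.some.inj hb]
  · rintro (rfl | ⟨z, b, hz, hb, rfl⟩)
    · exact ⟨h, a, Nat.lt_succ_self h, ha, rfl⟩
    · exact ⟨z, b, hz.trans (Nat.lt_succ_self h), hb, rfl⟩

open Classical in
/-- The counter values after pending increments. -/
noncomputable def raised (n : ℕ) (r : J → Prop) (u : J → ℕ) : J → ℕ :=
  fun j => if r j then min n (u j + 1) else u j

theorem within_natCast {N : NTM A} {n h : ℕ} {s : N.State} {T : ℤ → Option N.Sym} (hh : h ≤ n) :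
    (NTM.Config.mk (M := N) s h T).Within n :=
  ⟨by simp, by simpa using hh⟩

/-- Since `h < v - 1` means `h + 1 < v`, a decrement shifts a unary track one square to the left; a
left sweep can do this by carrying the column of the square on the right. -/
theorem baseColumn_iff {v : J → ℕ} (act : J → CounterOp J) (h : ℕ) (j : J) :
    baseColumn act (fun j => h < v j) (fun j => h + 1 < v j) j ↔ h < (act j).base v := by
  unfold baseColumn CounterOp.base
  split <;> simp
  omega

variable [Finite A] [Finite J] (M : CounterMachine A J)

theorem toNTM_isDeterministic : M.toNTM.IsDeterministic := by
  intro s a x y hx hy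
  exact Option.some.inj ((show sweep M s a = some x from hx).symm.trans hy)

variable {M} in
theorem step_of_sweep {c d : M.toNTM.Config} {q : SweepState M.State A J}
    {a : Option (A × (J → Prop) × Prop)} {v : HeadMove}
    (h : sweep M c.state (c.tape c.head) = some (q, a, v))
    (hd : d = ⟨q, c.head + v.shift, Function.update c.tape c.head a⟩) : M.toNTM.Step c d :=
  ⟨q, a, v, h, hd⟩

/-- The simulating machine in its right sweep at the square `h`. -/
noncomputable def rightConfig (w : List A) (q : M.State) (r : J → Prop) (u : J → ℕ) (h : ℕ) :
    M.toNTM.Config where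
  state := .right q r (fun j => h < u j + 1) (viewTo w (raised w.length r u) h)
  head := h
  tape := tape w fun z => if z < h then raised w.length r u else u

/-- The simulating machine in its left sweep at the square `h`. -/
noncomputable def leftConfig (w : List A) (q : M.State) (act : J → CounterOp J) (v : J → ℕ)
    (h : ℕ) : M.toNTM.Config where
  state := .left q act (fun j => h + 1 < v j)
  head := h
  tape := tape w fun z => if z ≤ h then v else fun j => (act j).base v

open Classical in
-- An increment shifts a unary track one square to the right, so the state carries the old column of
-- the previous square, and all counters on entering the leftmost one. The cap `min n` costs
-- nothing, as the track ends with the input.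
theorem step_rightConfig (w : List A) (q : M.State) (r : J → Prop) (u : J → ℕ) {h : ℕ}
    (hh : h < w.length) :
    M.toNTM.Step (rightConfig M w q r u h) (rightConfig M w q r u (h + 1)) := by
  have ha : w[h]? = some w[h] := List.getElem?_eq_getElem hh
  have hτ : ∀ j, (if r j then h < u j + 1 else h < u j) ↔ h < raised w.length r u j := by
    intro j
    unfold raised
    split_ifs
    · rw [lt_min_iff]; exact ⟨fun h => ⟨hh, h⟩, fun h => h.2⟩
    · rfl
  refine step_of_sweep (q := .right q r (fun j => h < u j) (viewTo w (raised w.length r u) (h + 1)))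
    (a := some (w[h], fun j => if r j then h < u j + 1 else h < u j, h = 0)) (v := .right) ?_ ?_
  rotate_left
  · unfold rightConfig
    congr 1
    · simp
    symm
    exact update_tape w (V := fun z => if z < h then raised w.length r u else u)
      (V' := fun z => if z < h + 1 then raised w.length r u else u) ha
      (τ := fun j => if r j then h < u j + 1 else h < u j)
      (fun z hz => by simp only [Nat.lt_succ_iff_lt_or_eq, hz, or_false])
      (fun j => by rw [hτ j]; simp)
  · have hs : (rightConfig M w q r u h).tape (rightConfig M w q r u h).head =
        some (w[h], fun j => h < u j, h = 0) := by
      simp only [rightConfig, tape_natCast, ha, Option.map_some, lt_irrefl, if_false]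
    rw [hs]
    simp only [rightConfig, sweep]
    rw [viewTo_succ w _ h ha]
    rw [← (funext fun j => propext (hτ j) : (fun j => if r j then h < u j + 1 else h < u j) =
        fun j => h < raised w.length r u j)]

theorem steps_rightConfig (w : List A) (q : M.State) (r : J → Prop) (u : J → ℕ) (h : ℕ)
    (hh : h ≤ w.length) :
    M.toNTM.StepsWithin w.length h (rightConfig M w q r u 0) (rightConfig M w q r u h) := by
  induction h with
  | zero => exact ⟨rfl, within_natCast (Nat.zero_le _)⟩
  | succ h ih =>
    exact (ih (by omega)).trans (.single (step_rightConfig M w q r u hh)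
      (within_natCast (by omega)) (within_natCast hh))

/-- There are `h` moves to the left and one step in place on the marked square, where the sweep
turns. -/
theorem steps_leftConfig (w : List A) (q : M.State) (act : J → CounterOp J) (v : J → ℕ) (h : ℕ)
    (hh : h < w.length) :
    M.toNTM.StepsWithin w.length (h + 1) (leftConfig M w q act v h)
      (rightConfig M w q (fun j => (act j).Raises) (fun j => (act j).base v) 0) := by
  have ha : w[h]? = some w[h] := List.getElem?_eq_getElem hh
  have hs : (leftConfig M w q act v h).tape (leftConfig M w q act v h).head =
      some (w[h], fun j => h < v j, h = 0) := by
    simp only [leftConfig, tape_natCast, ha, Option.map_some, le_refl, if_true]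
  induction h with
  | zero =>
    refine .single (step_of_sweep (q := .right q (fun j => (act j).Raises) (fun _ => True) ∅)
      (a := some (w[0], baseColumn act (fun j => 0 < v j) (fun j => 0 + 1 < v j), 0 = 0))
      (v := .stay) ?_ ?_) (within_natCast hh.le) (within_natCast hh.le)
    rotate_left
    · unfold rightConfig
      congr 1
      · simp [viewTo]
      · symm
        exact update_tape w (V := fun z => if z ≤ 0 then v else fun j => (act j).base v)
          (V' := fun z => if z < 0 then _ else fun j => (act j).base v) ha
          (fun z hz => by simp [hz]) (fun j => by rw [baseColumn_iff]; simp)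
    · rw [hs]
      simp [leftConfig, sweep]
  | succ h ih =>
    have ha' : w[h]? = some w[h] := List.getElem?_eq_getElem (by omega)
    rw [add_comm (h + 1) 1]
    refine .trans (.single (step_of_sweep (q := .left q act (fun j => h + 1 < v j))
      (a := some (w[h + 1], baseColumn act (fun j => h + 1 < v j) (fun j => h + 1 + 1 < v j),
        h + 1 = 0)) (v := .left) ?_ ?_) (within_natCast hh.le)
      (within_natCast (by omega))) (ih (by omega) ha' ?_)
    · rw [hs]
      simp [leftConfig, sweep]
    · unfold leftConfig
      congr 1
      · simp [HeadMove.shift]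
      · symm
        refine update_tape w (V := fun z => if z ≤ h + 1 then v else fun j => (act j).base v)
          (V' := fun z => if z ≤ h then v else fun j => (act j).base v) ha
          (fun z hz => ?_) (fun j => ?_)
        · have : z ≤ h + 1 ↔ z ≤ h := by omega
          simp [this]
        · rw [baseColumn_iff]; simp
    · simp only [leftConfig, tape_natCast, ha', Option.map_some, le_refl, if_true]

theorem rightConfig_length (w : List A) (q : M.State) (r : J → Prop) (u : J → ℕ) :
    rightConfig M w q r u w.length =
      ⟨.right q r (fun j => w.length < u j + 1) (view w (raised w.length r u)), w.length,
        tape w fun _ => raised w.length r u⟩ := by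
  unfold rightConfig view
  congr 1
  exact tape_congr w fun z hz => by simp [hz]

/-- The right sweep takes `w.length` steps, the turn on the blank square one step, and the left
sweep `w.length` steps. -/
theorem steps_of_next {w : List A} (hw : w ≠ []) {q : M.State} {r : J → Prop} {u : J → ℕ}
    (hu : ∀ j, raised w.length r u j ≤ w.length) {q' : M.State} {act : J → CounterOp J}
    (h : M.trans q (view w (raised w.length r u)) = some (q', act)) :
    M.toNTM.StepsWithin w.length (2 * w.length + 1) (rightConfig M w q r u 0)
      (rightConfig M w q' (fun j => (act j).Raises)
        (fun j => (act j).base (raised w.length r u)) 0) := by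
  have hl : 0 < w.length := List.length_pos_iff.2 hw
  obtain ⟨m, hm⟩ : ∃ m, w.length = m + 1 := ⟨w.length - 1, by omega⟩
  have h1 := steps_rightConfig M w q r u w.length le_rfl
  have h3 := steps_leftConfig M w q' act (raised w.length r u) m (by omega)
  have h2 : M.toNTM.Step (rightConfig M w q r u w.length)
      (leftConfig M w q' act (raised w.length r u) m) := by
    rw [rightConfig_length]
    refine step_of_sweep (q := .left q' act (fun _ => False)) (a := none) (v := .left) ?_ ?_
    · simp only [tape_natCast, List.getElem?_length, Option.map_none, sweep, h]
    · unfold leftConfig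
      congr 1
      · congr 1
        funext j
        rw [← hm]
        -- No counter exceeds `w.length`, so the column beyond the input is empty and the left sweep
        -- may start from `False`.
        exact propext ⟨fun h => absurd (hu j) (by omega), False.elim⟩
      · simp [hm, HeadMove.shift]
      · symm
        rw [update_tape_none]
        exact tape_congr w fun z hz => by
          have : z ≤ m := by omega
          simp [this]
  have := (h1.trans (.single h2 (within_natCast le_rfl) (within_natCast (by omega)))).trans h3
  convert this using 1
  omega

/-- Between counter steps the tape holds base values `u` while the increments `r` are still pending;
the true counter values are only present as `raised w.length r u`. -/
theorem steps_of_runs {w : List A} (hw : w ≠ []) {k : ℕ} {q : M.State} {r : J → Prop} {u : J → ℕ}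
    (hu : ∀ j, raised w.length r u j ≤ w.length) {d : M.State × (J → ℕ)}
    (h : M.Runs w k (q, raised w.length r u) d) :
    ∃ r' u', d.2 = raised w.length r' u' ∧
      M.toNTM.StepsWithin w.length (k * (2 * w.length + 1)) (rightConfig M w q r u 0)
        (rightConfig M w d.1 r' u' 0) := by
  induction k generalizing q r u with
  | zero =>
    obtain rfl : _ = d := h
    exact ⟨r, u, rfl, by rw [Nat.zero_mul]; exact ⟨rfl, within_natCast (Nat.zero_le _)⟩⟩
  | succ k ih =>
    obtain ⟨e, h1, h2⟩ := h
    simp only [next, Option.map_eq_some_iff] at h1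
    obtain ⟨⟨q', act⟩, h3, rfl⟩ := h1
    have he : (fun j => (act j).apply w.length (raised w.length r u)) =
        raised w.length (fun j => (act j).Raises) (fun j => (act j).base (raised w.length r u)) :=
      funext fun j => CounterOp.apply_eq _ _ _
    simp only [he] at h2
    obtain ⟨r', u', h4, h5⟩ := ih (fun j => by
      rw [← congrFun he j]; exact CounterOp.apply_le hu _) h2
    refine ⟨r', u', h4, ?_⟩
    rw [Nat.succ_mul, Nat.add_comm]
    exact (steps_of_next M hw hu h3).trans h5

/-- All tracks of the input are empty, so all counters are zero; the only thing missing is the mark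
on the leftmost square. -/
theorem step_init {w : List A} (hw : w ≠ []) :
    M.toNTM.Step (M.toNTM.init w) (rightConfig M w M.start (fun _ => False) (fun _ => 0) 0) := by
  have hl : 0 < w.length := List.length_pos_iff.2 hw
  have ha : w[0]? = some w[0] := List.getElem?_eq_getElem hl
  refine step_of_sweep (q := .right M.start (fun _ => False) (fun _ => True) ∅)
    (a := some (w[0], fun _ => False, True)) (v := .stay) ?_ ?_
  rotate_left
  · unfold rightConfig
    congr 1
    · simp [viewTo]
    funext z
    by_cases hz : z = 0
    · subst hz
      simp [NTM.init, tape, ha]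
    · rw [show (M.toNTM.init w).head = 0 from rfl, Function.update_of_ne hz]
      change tape w _ z =
        if 0 ≤ z then (w[z.toNat]?).map (fun a => (a, (fun _ : J => False), False)) else none
      unfold tape
      by_cases h0 : 0 ≤ z
      · have : z.toNat ≠ 0 := by omega
        simp [h0, this]
      · simp [h0]
  · have : (M.toNTM.init w).tape (M.toNTM.init w).head =
        some (w[0], fun _ => False, False) :=
      (if_pos (e := none) (le_refl (0 : ℤ))).trans
        (congrArg (Option.map fun a => (a, (fun _ : J => False), False)) ha)
    rw [this]
    simp [sweep, NTM.init, toNTM]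

theorem halts_done {c : M.toNTM.Config} (h : c.state = .done) (d : M.toNTM.Config) :
    ¬ M.toNTM.Step c d := by
  rintro ⟨q, a, v, h1, -⟩
  change sweep M c.state _ = some _ at h1
  rw [h] at h1
  simp [sweep] at h1

open Classical in
-- A last right sweep brings the head to the blank square, where the machine either is stuck or
-- takes one more step to `done`.
theorem steps_of_halting {w : List A} {q : M.State} {r : J → Prop} {u : J → ℕ}
    (h : M.trans q (view w (raised w.length r u)) = none) :
    ∃ k ≤ w.length + 1, ∃ e, M.toNTM.StepsWithin w.length k (rightConfig M w q r u 0) e ∧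
      (∀ d, ¬ M.toNTM.Step e d) ∧ (e.state = .done ↔ q ∈ M.accept) := by
  have h1 := steps_rightConfig M w q r u w.length le_rfl
  have hs : sweep M (rightConfig M w q r u w.length).state
      ((rightConfig M w q r u w.length).tape (rightConfig M w q r u w.length).head) =
      if q ∈ M.accept then some (.done, none, .stay) else none := by
    rw [rightConfig_length]
    simp only [tape_natCast, List.getElem?_length, Option.map_none, sweep, h]
  by_cases hq : q ∈ M.accept
  · rw [if_pos hq] at hs
    refine ⟨w.length + 1, le_rfl, _, h1.trans (.single (step_of_sweep hs rfl)
      (within_natCast le_rfl) ?_), fun d => halts_done M rfl d, ?_⟩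
    · constructor <;> simp [rightConfig, HeadMove.shift]
    · exact ⟨fun _ => hq, fun _ => rfl⟩
  · rw [if_neg hq] at hs
    refine ⟨w.length, by omega, _, h1, ?_, ?_⟩
    · rintro d ⟨q, a, v, h1, -⟩
      change sweep M _ _ = some _ at h1
      rw [hs] at h1
      simp at h1
    · refine ⟨fun h => ?_, fun h => absurd h hq⟩
      simp [rightConfig] at h

/-- A language of nonempty words that is decided by a bounded counter machine in polynomial time
is accepted by a linear-bounded Turing machine in polynomial time. -/
theorem exists_ntm (L : Language A) (P : Polynomial ℕ) (hnil : [] ∉ L)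
    (h : ∀ w : List A, w ≠ [] → ∃ k ≤ P.eval w.length, ∃ d, M.Runs w k (M.start, fun _ => 0) d ∧
      M.next w d = none ∧ (d.1 ∈ M.accept ↔ w ∈ L)) :
    ∃ N : NTM A, N.IsLinearBounded ∧ N.RunsInPolynomialTime ∧ N.language = L := by
  -- The bound adds one initial step, `2 * w.length + 1` steps for each counter step, and at most
  -- `w.length + 1` steps until halting.
  have key : ∀ w : List A, ∃ k ≤ (Polynomial.X + 2 + P * (2 * Polynomial.X + 1)).eval w.length,
      ∃ e, M.toNTM.StepsWithin w.length k (M.toNTM.init w) e ∧ (∀ d, ¬ M.toNTM.Step e d) ∧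
        (e.state = .done ↔ w ∈ L) := by
    intro w
    by_cases hw : w = []
    · subst hw
      -- On the empty input the machine sees a blank in its initial state and is stuck at once.
      refine ⟨0, Nat.zero_le _, _, ⟨rfl, ⟨le_rfl, le_rfl⟩⟩, ?_, ?_⟩
      · rintro d ⟨q, a, v, h1, -⟩
        change sweep M _ _ = some _ at h1
        simp [NTM.init, toNTM, sweep] at h1
      · simp [NTM.init, toNTM, hnil]
    · obtain ⟨k, hk, d, h1, h2, h3⟩ := h w hw
      have h0 : (fun _ : J => 0) = raised w.length (fun _ => False) (fun _ => 0) := by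
        funext j; simp [raised]
      rw [h0] at h1
      obtain ⟨r, u, h4, h5⟩ := steps_of_runs M hw (fun j => by simp [raised]) h1
      simp only [next, Option.map_eq_none_iff] at h2
      rw [h4] at h2
      obtain ⟨l, hl, e, h6, h7, h8⟩ := steps_of_halting M h2
      refine ⟨1 + k * (2 * w.length + 1) + l, ?_, e,
        ((NTM.StepsWithin.single (step_init M hw) ?_ ?_).trans h5).trans h6, h7, h8.trans h3⟩
      · have := Nat.mul_le_mul_right (2 * w.length + 1) hk
        simp only [Polynomial.eval_add, Polynomial.eval_mul, Polynomial.eval_X,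
          Polynomial.eval_ofNat, Polynomial.eval_one]
        omega
      · constructor <;> simp [NTM.init]
      · exact within_natCast (Nat.zero_le _)
  refine ⟨M.toNTM, fun w n c hc => ?_,
    ⟨Polynomial.X + 2 + P * (2 * Polynomial.X + 1), fun w n c hc => ?_⟩, ?_⟩
  · obtain ⟨k, -, e, h1, h2, -⟩ := key w
    exact ((toNTM_isDeterministic M).stepsTo_of_halts h1 h2 hc).2.1
  · obtain ⟨k, hk, e, h1, h2, -⟩ := key w
    exact (((toNTM_isDeterministic M).stepsTo_of_halts h1 h2 hc).1).trans hk
  · ext w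
    obtain ⟨k, -, e, h1, h2, h3⟩ := key w
    constructor
    · rintro ⟨n, c, hc, hacc⟩
      have hacc : c.state = .done := hacc
      have := ((toNTM_isDeterministic M).stepsTo_of_halts h1 h2 hc).2.2 (halts_done M hacc)
      exact h3.1 (this ▸ hacc)
    · intro hw
      exact ⟨k, e, h1.stepsTo, h3.2 hw⟩

end CounterMachine

/-! ### Context-sensitive grammars of linear-bounded automata -/

namespace NTM

variable {A : Type} (M : NTM A)

/-- The content of a square together with the state, if the head is there. -/
abbrev Cell : Type := Option M.Sym × Option M.State

/-- The square `z` in a configuration. -/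
def cellAt {M : NTM A} (c : M.Config) (z : ℕ) : M.Cell :=
  (c.tape z, if c.head = z then some c.state else none)

/-- The squares `0, …, n` in a configuration. -/
def cells {M : NTM A} (n : ℕ) (c : M.Config) : List M.Cell :=
  (List.range (n + 1)).map (cellAt c)

/-- The local effect of one step on the squares. -/
inductive CellRule : List M.Cell → List M.Cell → Prop
  | stay {q q' : M.State} {b b' : Option M.Sym} (h : (q', b', HeadMove.stay) ∈ M.trans q b) :
      CellRule [(b, some q)] [(b', some q')]
  | right {q q' : M.State} {b b' : Option M.Sym} (e : Option M.Sym)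
      (h : (q', b', HeadMove.right) ∈ M.trans q b) :
      CellRule [(b, some q), (e, none)] [(b', none), (e, some q')]
  | left {q q' : M.State} {b b' : Option M.Sym} (e : Option M.Sym)
      (h : (q', b', HeadMove.left) ∈ M.trans q b) :
      CellRule [(e, none), (b, some q)] [(e, some q'), (b', none)]

/-- One application of a local rule. -/
def CellStep (u v : List M.Cell) : Prop :=
  ∃ x y α β, M.CellRule α β ∧ u = x ++ (α ++ y) ∧ v = x ++ (β ++ y)

variable {M}

/-! ### Steps of a machine as local rewriting of the list of squares. -/

theorem map_range_eq_append {β : Type*} {f : ℕ → β} {N : ℕ} {x α y : List β}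
    (h : (List.range N).map f = x ++ (α ++ y)) :
    N = x.length + (α.length + y.length) ∧ x = (List.range x.length).map f ∧
      α = (List.range α.length).map (fun i => f (x.length + i)) ∧
      y = (List.range y.length).map (fun i => f (x.length + (α.length + i))) := by
  have hN : N = x.length + (α.length + y.length) := by
    have := congrArg List.length h; simpa using this
  refine ⟨hN, ?_⟩
  rw [hN, List.range_add, List.range_add, List.map_append, List.map_map, List.map_append,
    List.map_map] at h
  obtain ⟨h1, h2⟩ := List.append_inj h (by simp)
  obtain ⟨h3, h4⟩ := List.append_inj h2 (by simp)
  exact ⟨h1.symm, h3.symm, h4.symm⟩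

theorem map_range_append {β : Type*} (f : ℕ → β) (a b c : ℕ) :
    (List.range (a + (b + c))).map f = (List.range a).map f ++
      ((List.range b).map (fun i => f (a + i)) ++
        (List.range c).map (fun i => f (a + (b + i)))) := by
  rw [List.range_add, List.range_add, List.map_append, List.map_map, List.map_append, List.map_map]
  rfl

theorem cellStep_of_congr {f g : ℕ → M.Cell} {a b c : ℕ}
    (h : M.CellRule ((List.range b).map fun i => f (a + i)) ((List.range b).map fun i => g (a + i)))
    (h1 : ∀ z < a, f z = g z) (h2 : ∀ z, a + b ≤ z → f z = g z) :
    M.CellStep ((List.range (a + (b + c))).map f) ((List.range (a + (b + c))).map g) := by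
  refine ⟨_, _, _, _, h, map_range_append f a b c, ?_⟩
  rw [map_range_append]
  congr 1
  · exact List.map_congr_left fun z hz => (h1 z (List.mem_range.1 hz)).symm
  · congr 1
    exact List.map_congr_left fun z hz => (h2 _ (by omega)).symm

theorem cellAt_update_of_ne {c : M.Config} {q : M.State} {k : ℤ} {a : Option M.Sym} {z : ℕ}
    (h1 : c.head ≠ z) (h2 : k ≠ z) :
    cellAt ⟨q, k, Function.update c.tape c.head a⟩ z = cellAt c z := by
  simp [cellAt, h1, h2, Function.update_of_ne (Ne.symm h1)]

/-- One step affects only the square of the head and, if it moves, the one it moves to. Both lie in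
the list because the head stays on the squares `0, …, n`. -/
theorem cellStep_of_step {n : ℕ} {c d : M.Config} (h : M.Step c d) (hc : c.Within n)
    (hd : d.Within n) : M.CellStep (cells n c) (cells n d) := by
  obtain ⟨q, a, v, h, rfl⟩ := h
  obtain ⟨hc1, hc2⟩ := hc
  obtain ⟨hd1, hd2⟩ := hd
  obtain ⟨k, hk⟩ := Int.eq_ofNat_of_zero_le hc1
  unfold cells
  cases v with
  | stay =>
    simp only [HeadMove.shift] at *
    obtain ⟨m, hm⟩ : ∃ m, n + 1 = k + (1 + m) := ⟨n - k, by omega⟩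
    rw [hm]
    refine cellStep_of_congr ?_ (fun z hz => ?_) (fun z hz => ?_)
    · simp only [List.range_one, List.map_cons, List.map_nil, add_zero, cellAt, hk, if_true,
        Function.update_self]
      rw [hk] at h
      exact .stay h
    · rw [cellAt_update_of_ne] <;> omega
    · rw [cellAt_update_of_ne] <;> omega
  | right =>
    simp only [HeadMove.shift] at *
    obtain ⟨m, hm⟩ : ∃ m, n + 1 = k + (2 + m) := ⟨n - k - 1, by omega⟩
    rw [hm]
    refine cellStep_of_congr ?_ (fun z hz => ?_) (fun z hz => ?_)
    · have h2 : List.range 2 = [0, 1] := rfl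
      have hne : ((k + 1 : ℕ) : ℤ) ≠ (k : ℤ) := by omega
      have e1 : ((k : ℤ) + 1 = ((k + 1 : ℕ) : ℤ)) := by push_cast; rfl
      simp only [h2, List.map_cons, List.map_nil, add_zero, cellAt, hk, if_true,
        Function.update_self, Function.update_of_ne hne, e1, if_neg hne, if_neg hne.symm]
      rw [hk] at h
      exact .right _ h
    · rw [cellAt_update_of_ne] <;> omega
    · rw [cellAt_update_of_ne] <;> omega
  | left =>
    simp only [HeadMove.shift] at *
    obtain ⟨l, rfl⟩ : ∃ l, k = l + 1 := ⟨k - 1, by omega⟩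
    obtain ⟨m, hm⟩ : ∃ m, n + 1 = l + (2 + m) := ⟨n - l - 1, by omega⟩
    rw [hm]
    refine cellStep_of_congr ?_ (fun z hz => ?_) (fun z hz => ?_)
    · have h2 : List.range 2 = [0, 1] := rfl
      have hne : ((l + 1 : ℕ) : ℤ) ≠ (l : ℤ) := by omega
      have e1 : ((l + 1 : ℕ) : ℤ) + -1 = (l : ℤ) := by push_cast; ring
      simp only [h2, List.map_cons, List.map_nil, add_zero, cellAt, hk, if_true,
        Function.update_self, Function.update_of_ne hne.symm, e1, if_neg hne, if_neg hne.symm]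
      rw [hk] at h
      exact .left _ h
    · rw [cellAt_update_of_ne] <;> omega
    · rw [cellAt_update_of_ne] <;> omega

theorem cells_eq_of_congr {n : ℕ} {c : M.Config} {x α y β : List M.Cell} {g : ℕ → M.Cell}
    (h : cells n c = x ++ (α ++ y)) (hβ : β = (List.range α.length).map fun i => g (x.length + i))
    (h1 : ∀ z < x.length, g z = cellAt c z) (h2 : ∀ z, x.length + α.length ≤ z → g z = cellAt c z) :
    (List.range (n + 1)).map g = x ++ (β ++ y) := by
  obtain ⟨hn, hx, hα, hy⟩ := map_range_eq_append h
  rw [hn, map_range_append, ← hβ]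
  congr 1
  · rw [hx, List.length_map, List.length_range]
    exact List.map_congr_left fun z hz => h1 z (List.mem_range.1 hz)
  · congr 1
    rw [hy, List.length_map, List.length_range]
    exact List.map_congr_left fun z hz => h2 _ (by omega)

theorem cellAt_eq_some {c : M.Config} {z : ℕ} {b : Option M.Sym} {q : M.State}
    (h : cellAt c z = (b, some q)) : c.head = z ∧ c.state = q ∧ c.tape c.head = b := by
  simp only [cellAt, Prod.mk.injEq, ite_eq_iff, reduceCtorEq, and_false, or_false,
    Option.some.injEq] at h
  obtain ⟨h1, h2, h3⟩ := h
  exact ⟨h2, h3, by rw [h2, h1]⟩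

/-- Every left side of a local rule contains a state, and in a configuration only the square of the
head does. So the place where the rule applies and the transition it uses are those of a genuine
step. -/
theorem exists_step_of_cellStep {n : ℕ} {c : M.Config} {v : List M.Cell}
    (h : M.CellStep (cells n c) v) : ∃ d, M.Step c d ∧ v = cells n d := by
  obtain ⟨x, y, α, β, hr, h1, rfl⟩ := h
  obtain ⟨hn, -, hα, -⟩ := map_range_eq_append h1
  have h2 : List.range 2 = [0, 1] := rfl
  cases hr with
  | @stay q q' b b' h =>
    simp only [List.length_singleton, List.range_one, List.map_cons, List.map_nil, add_zero,
      List.cons.injEq, and_true] at hα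
    obtain ⟨e1, e2, e3⟩ := cellAt_eq_some hα.symm
    refine ⟨⟨q', c.head + 0, Function.update c.tape c.head b'⟩,
      ⟨q', b', .stay, by rw [e2, e3]; exact h, rfl⟩, ?_⟩
    symm
    refine cells_eq_of_congr h1 ?_ (fun z hz => ?_) (fun z hz => ?_)
    · simp [cellAt, e1]
    · rw [cellAt_update_of_ne] <;> omega
    · simp only [List.length_singleton] at hz
      rw [cellAt_update_of_ne] <;> omega
  | @right q q' b b' e h =>
    simp only [List.length_cons, List.length_nil, zero_add, Nat.reduceAdd, h2, List.map_cons,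
      List.map_nil, add_zero, List.cons.injEq, and_true] at hα
    obtain ⟨e1, e2, e3⟩ := cellAt_eq_some hα.1.symm
    refine ⟨⟨q', c.head + 1, Function.update c.tape c.head b'⟩,
      ⟨q', b', .right, by rw [e2, e3]; exact h, rfl⟩, ?_⟩
    symm
    refine cells_eq_of_congr h1 ?_ (fun z hz => ?_) (fun z hz => ?_)
    · have e4 := congrArg Prod.fst hα.2
      simp only [cellAt] at e4
      simp only [List.length_cons, List.length_nil, zero_add, Nat.reduceAdd, h2, List.map_cons,
        List.map_nil, add_zero, cellAt, e1, Function.update_self]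
      rw [Function.update_of_ne (by omega), ← e4]
      simp
    · rw [cellAt_update_of_ne] <;> omega
    · simp only [List.length_cons, List.length_nil] at hz
      rw [cellAt_update_of_ne] <;> omega
  | @left q q' b b' e h =>
    simp only [List.length_cons, List.length_nil, zero_add, Nat.reduceAdd, h2, List.map_cons,
      List.map_nil, add_zero, List.cons.injEq, and_true] at hα
    obtain ⟨e1, e2, e3⟩ := cellAt_eq_some hα.2.symm
    refine ⟨⟨q', c.head + -1, Function.update c.tape c.head b'⟩,
      ⟨q', b', .left, by rw [e2, e3]; exact h, rfl⟩, ?_⟩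
    symm
    refine cells_eq_of_congr h1 ?_ (fun z hz => ?_) (fun z hz => ?_)
    · have e4 := congrArg Prod.fst hα.1
      simp only [cellAt] at e4
      simp only [List.length_cons, List.length_nil, zero_add, Nat.reduceAdd, h2, List.map_cons,
        List.map_nil, add_zero, cellAt, e1, Function.update_self]
      rw [Function.update_of_ne (by omega), ← e4]
      simp
    · rw [cellAt_update_of_ne] <;> omega
    · simp only [List.length_cons, List.length_nil] at hz
      rw [cellAt_update_of_ne] <;> omega

/-! Sentential forms: the last nonterminal carries two squares. -/

variable (M)

/-- An input letter with one or two squares. -/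
abbrev Block : Type := A × M.Cell × Option M.Cell

variable {M}

/-- The squares of a list of blocks. -/
def expand (U : List M.Block) : List M.Cell :=
  U.flatMap fun x => x.2.1 :: x.2.2.toList

theorem expand_append (U V : List M.Block) : expand (U ++ V) = expand U ++ expand V := by
  simp [expand]

theorem expand_cons (x : M.Block) (U : List M.Block) :
    expand (x :: U) = x.2.1 :: (x.2.2.toList ++ expand U) := by
  simp [expand]

/-- A local step of the squares takes place in at most two adjacent blocks. -/
theorem exists_blocks_of_cellRule {α β x y : List M.Cell} (h : M.CellRule α β) {U : List M.Block}
    (hU : expand U = x ++ (α ++ y)) :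
    ∃ X W W' Y : List M.Block, U = X ++ (W ++ Y) ∧ W.length ≤ 2 ∧
      W.map Prod.fst = W'.map Prod.fst ∧ M.CellStep (expand W) (expand W') ∧
      expand (X ++ (W' ++ Y)) = x ++ (β ++ y) := by
  induction U generalizing x with
  | nil => cases h <;> simp [expand] at hU
  | cons b U ih =>
    obtain ⟨a, c, e⟩ := b
    rw [expand_cons] at hU
    -- Either the local rule starts behind the first block, or it starts inside this block.
    by_cases hx : ∃ x', x = c :: (e.toList ++ x')
    · obtain ⟨x', rfl⟩ := hx
      simp only [List.cons_append, List.append_assoc, List.cons.injEq, true_and,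
        List.append_cancel_left_eq] at hU
      obtain ⟨X, W, W', Y, h1, h2, h3, h4, h5⟩ := ih hU
      refine ⟨(a, c, e) :: X, W, W', Y, by simp [h1], h2, h3, h4, ?_⟩
      rw [List.cons_append, expand_cons, h5]
      simp
    · have single : ∀ c' e', M.CellStep (expand [(a, c, e)]) (expand [(a, c', e')]) →
          c' :: (e'.toList ++ expand U) = x ++ (β ++ y) →
          ∃ X W W' Y : List M.Block, (a, c, e) :: U = X ++ (W ++ Y) ∧ W.length ≤ 2 ∧
            W.map Prod.fst = W'.map Prod.fst ∧ M.CellStep (expand W) (expand W') ∧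
            expand (X ++ (W' ++ Y)) = x ++ (β ++ y) := fun c' e' h1 h2 =>
        ⟨[], [(a, c, e)], [(a, c', e')], U, rfl, by simp, rfl, h1, by
          rw [← h2]; simp [expand]⟩
      -- A rule that starts in the first block and runs over its end changes only the first square
      -- of the second block.
      have double : ∀ a₁ c₁ e₁ U' c' e' c₁', U = (a₁, c₁, e₁) :: U' →
          M.CellStep (expand [(a, c, e), (a₁, c₁, e₁)]) (expand [(a, c', e'), (a₁, c₁', e₁)]) →
          c' :: (e'.toList ++ c₁' :: (e₁.toList ++ expand U')) = x ++ (β ++ y) →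
          ∃ X W W' Y : List M.Block, (a, c, e) :: U = X ++ (W ++ Y) ∧ W.length ≤ 2 ∧
            W.map Prod.fst = W'.map Prod.fst ∧ M.CellStep (expand W) (expand W') ∧
            expand (X ++ (W' ++ Y)) = x ++ (β ++ y) := fun a₁ c₁ e₁ U' c' e' c₁' hU h1 h2 =>
        ⟨[], [(a, c, e), (a₁, c₁, e₁)], [(a, c', e'), (a₁, c₁', e₁)], U', by simp [hU], by simp,
          rfl, h1, by rw [← h2]; simp [expand]⟩
      -- Now `x` is a proper initial part of the squares of the first block.
      have hxe : x = [] ∨ ∃ c', e = some c' ∧ x = [c] := by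
        rcases x with _ | ⟨x0, x⟩
        · exact Or.inl rfl
        · simp only [List.cons_append, List.cons.injEq] at hU
          obtain ⟨rfl, hU⟩ := hU
          cases e with
          | none => exact absurd ⟨x, by simp⟩ hx
          | some c' =>
            rcases x with _ | ⟨x1, x⟩
            · exact Or.inr ⟨c', rfl, rfl⟩
            · simp at hU
              obtain ⟨rfl, hU⟩ := hU
              exact absurd ⟨x, by simp⟩ hx
      obtain ⟨α₀, hα⟩ | ⟨α₀, α₁, hα⟩ : (∃ α₀, α = [α₀]) ∨ ∃ α₀ α₁, α = [α₀, α₁] := by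
        cases h <;> simp
      · obtain ⟨β₀, hβ⟩ : ∃ β₀, β = [β₀] := by cases h <;> simp_all
        subst hα hβ
        rcases hxe with rfl | ⟨c', rfl, rfl⟩
        · simp only [List.nil_append, List.singleton_append, List.cons.injEq] at hU
          obtain ⟨rfl, rfl⟩ := hU
          exact single β₀ e ⟨[], e.toList, _, _, h, by simp [expand], by simp [expand]⟩ (by simp)
        · simp at hU
          obtain ⟨rfl, rfl⟩ := hU
          exact single c (some β₀) ⟨[c], [], _, _, h, by simp [expand], by simp [expand]⟩ (by simp)
      · obtain ⟨β₀, β₁, hβ⟩ : ∃ β₀ β₁, β = [β₀, β₁] := by cases h <;> simp_all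
        subst hα hβ
        rcases hxe with rfl | ⟨c', rfl, rfl⟩
        · cases e with
          | some c' =>
            simp at hU
            obtain ⟨rfl, rfl, rfl⟩ := hU
            exact single β₀ (some β₁) ⟨[], [], _, _, h, by simp [expand], by simp [expand]⟩
              (by simp)
          | none =>
            rcases U with _ | ⟨⟨a₁, c₁, e₁⟩, U⟩
            · simp [expand] at hU
            · simp [expand_cons] at hU
              obtain ⟨rfl, rfl, rfl⟩ := hU
              exact double a₁ c₁ e₁ U β₀ none β₁ rfl
                ⟨[], e₁.toList, _, _, h, by simp [expand], by simp [expand]⟩ (by simp)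
        · rcases U with _ | ⟨⟨a₁, c₁, e₁⟩, U⟩
          · simp [expand] at hU
          · simp [expand_cons] at hU
            obtain ⟨rfl, rfl, rfl⟩ := hU
            exact double a₁ c₁ e₁ U c (some β₀) β₁ rfl
              ⟨[c], e₁.toList, _, _, h, by simp [expand], by simp [expand]⟩ (by simp)

theorem cells_init (a : A) (v : List A) :
    cells (a :: v).length (M.init (a :: v)) =
      (some (M.input a), some M.start) :: (v.map (fun b => (some (M.input b), none)) ++
        [(none, none)]) := by
  apply List.ext_getElem?
  intro i
  unfold cells
  rw [List.getElem?_map]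
  rcases i with _ | i
  · simp [cellAt, init]
  · rw [List.getElem?_cons_succ]
    rcases lt_trichotomy i v.length with h | h | h
    · rw [List.getElem?_range (by simp; omega), List.getElem?_append_left (by simpa using h)]
      simp [cellAt, init, h]
      omega
    · subst h
      rw [List.getElem?_range (by simp), List.getElem?_append_right (by simp)]
      simp [cellAt, init]
      omega
    · rw [List.getElem?_eq_none (by simp; omega), List.getElem?_eq_none (by simp; omega)]
      rfl
end NTM

/-! ### The grammar of an automaton and its derivations. -/

namespace NTM

variable {A : Type} (M : NTM A)

/-- The nonterminals of the grammar: the start symbol, a symbol that generates further blocks on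
its right, and the blocks. -/
inductive BlockNT
  | start
  | grow
  | block (x : M.Block)

theorem finite_blockNT [Finite A] : Finite M.BlockNT := by
  have := M.finiteState
  have := M.finiteSym
  refine Finite.of_surjective (α := Option (Option M.Block)) (fun
    | none => BlockNT.start
    | some none => BlockNT.grow
    | some (some x) => BlockNT.block x) ?_
  intro X
  cases X with
  | start => exact ⟨none, rfl⟩
  | grow => exact ⟨some none, rfl⟩
  | block x => exact ⟨some (some x), rfl⟩

variable {M}

/-- A block as a symbol of the grammar. -/
abbrev blockSymbol (x : M.Block) : Symbol A M.BlockNT := .nonterminal (.block x)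

variable (M)

/-- The productions. -/
inductive BlockRule : List (Symbol A M.BlockNT) → List (Symbol A M.BlockNT) → Prop
  | single (a : A) : BlockRule [.nonterminal .start]
      [blockSymbol (a, (some (M.input a), some M.start), some (none, none))]
  | last (a : A) : BlockRule [.nonterminal .start]
      [.nonterminal .grow, blockSymbol (a, (some (M.input a), none), some (none, none))]
  | more (a : A) : BlockRule [.nonterminal .grow]
      [.nonterminal .grow, blockSymbol (a, (some (M.input a), none), none)]
  | first (a : A) : BlockRule [.nonterminal .grow]
      [blockSymbol (a, (some (M.input a), some M.start), none)]
  | step {W W' : List M.Block} (hW : W.length ≤ 2) (h : W.map Prod.fst = W'.map Prod.fst)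
      (hs : M.CellStep (expand W) (expand W')) :
      BlockRule (W.map blockSymbol) (W'.map blockSymbol)
  | accept {x : M.Block} {b : Option M.Sym} {q : M.State} (hq : q ∈ M.accept)
      (h : (b, some q) ∈ expand [x]) : BlockRule [blockSymbol x] [.terminal x.1]
  | right (a : A) (x : M.Block) :
      BlockRule [.terminal a, blockSymbol x] [.terminal a, .terminal x.1]
  | left (a : A) (x : M.Block) :
      BlockRule [blockSymbol x, .terminal a] [.terminal x.1, .terminal a]

variable {M}

theorem ne_nil_of_cellStep {W W' : List M.Block} (h : M.CellStep (expand W) (expand W')) :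
    W ≠ [] := by
  rintro rfl
  obtain ⟨x, y, α, β, h1, h2, -⟩ := h
  cases h1 <;> simp [expand] at h2

variable (M) in
/-- One application of a production. -/
def BlockStep (u v : List (Symbol A M.BlockNT)) : Prop :=
  ∃ x y α β, M.BlockRule α β ∧ u = x ++ (α ++ y) ∧ v = x ++ (β ++ y)

theorem blockStep_of_blockRule {α β : List (Symbol A M.BlockNT)} (h : M.BlockRule α β)
    (x y : List (Symbol A M.BlockNT)) : M.BlockStep (x ++ (α ++ y)) (x ++ (β ++ y)) :=
  ⟨x, y, α, β, h, rfl, rfl⟩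

/-! Words accepted by the machine are generated. -/

/-- The blocks are produced from right to left: the last one, with the additional blank square,
comes first, and the leftmost one, with the head, ends the growth. -/
theorem derives_initial {w : List A} (hw : w ≠ []) :
    ∃ U : List M.Block, U.map Prod.fst = w ∧ expand U = cells w.length (M.init w) ∧
      Relation.ReflTransGen M.BlockStep [.nonterminal .start] (U.map blockSymbol) := by
  have grow : ∀ (v : List A) (b : A), Relation.ReflTransGen M.BlockStep
      [.nonterminal .start] (.nonterminal .grow ::
        (v.map (fun a => blockSymbol (a, (some (M.input a), none), none)) ++
          [blockSymbol (b, (some (M.input b), none), some (none, none))])) := by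
    intro v b
    induction v with
    | nil => exact .single (blockStep_of_blockRule (.last b) [] [])
    | cons a v ih => exact ih.tail (blockStep_of_blockRule (.more a) [] _)
  obtain ⟨a, v, rfl⟩ := List.exists_cons_of_ne_nil hw
  rw [cells_init]
  rcases List.eq_nil_or_concat v with rfl | ⟨v, b, rfl⟩
  · exact ⟨[(a, (some (M.input a), some M.start), some (none, none))], rfl, by simp [expand],
      .single (blockStep_of_blockRule (.single a) [] [])⟩
  · refine ⟨(a, (some (M.input a), some M.start), none) ::
      (v.map (fun a => (a, (some (M.input a), none), none)) ++
        [(b, (some (M.input b), none), some (none, none))]), ?_, ?_, ?_⟩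
    · simp [Function.comp_def]
    · have : ∀ v : List A, expand (v.map (fun a => ((a, (some (M.input a), none), none) : M.Block)))
          = v.map (fun b => (some (M.input b), none)) := fun v => by
        induction v with
        | nil => rfl
        | cons a v ih => rw [List.map_cons, expand_cons, ih]; rfl
      rw [expand_cons, expand_append, this]
      simp [expand]
    · refine (grow v b).tail ?_
      have := blockStep_of_blockRule (M := M) (.first a) []
        (v.map (fun a => blockSymbol (a, (some (M.input a), none), none)) ++
          [blockSymbol (b, (some (M.input b), none), some (none, none))])
      simpa [Function.comp_def] using this

theorem derives_of_stepsTo {w : List A} {n k : ℕ} {c d : M.Config} {U : List M.Block}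
    (hU : U.map Prod.fst = w) (hc : expand U = cells n c)
    (hin : ∀ j e, M.StepsTo j c e → e.Within n) (h : M.StepsTo k c d) :
    ∃ V : List M.Block, V.map Prod.fst = w ∧ expand V = cells n d ∧
      Relation.ReflTransGen M.BlockStep (U.map blockSymbol) (V.map blockSymbol) := by
  induction k generalizing c U with
  | zero =>
    obtain rfl : c = d := h
    exact ⟨U, hU, hc, .refl⟩
  | succ k ih =>
    obtain ⟨e, h1, h2⟩ := h
    obtain ⟨x, y, α, β, h3, h4, h5⟩ := cellStep_of_step h1 (hin 0 c rfl) (hin 1 e ⟨e, h1, rfl⟩)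
    obtain ⟨X, W, W', Y, rfl, h6, h7, h8, h9⟩ := exists_blocks_of_cellRule h3 (hc.trans h4)
    obtain ⟨V, h10, h11, h12⟩ := ih (U := X ++ (W' ++ Y)) (by rw [← hU]; simp [h7])
      (h9.trans h5.symm) (fun j f hf => hin (j + 1) f ⟨e, h1, hf⟩) h2
    refine ⟨V, h10, h11, .head ?_ h12⟩
    simpa using blockStep_of_blockRule (.step h6 h7 h8) (X.map blockSymbol) (Y.map blockSymbol)

/-- Once one block has become a letter, its neighbours may follow, so letters spread to both ends
without any further look at the squares. -/
theorem derives_right (P : List (Symbol A M.BlockNT)) (a : A) (Y : List M.Block) :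
    Relation.ReflTransGen M.BlockStep (P ++ .terminal a :: Y.map blockSymbol)
      (P ++ .terminal a :: Y.map fun x => .terminal x.1) := by
  induction Y generalizing P a with
  | nil => exact .refl
  | cons x Y ih =>
    refine .head (blockStep_of_blockRule (.right a x) P (Y.map blockSymbol)) ?_
    have := ih (P ++ [.terminal a]) x.1
    rw [List.append_assoc, List.append_assoc] at this
    exact this

theorem derives_left (X : List M.Block) (a : A) (Q : List (Symbol A M.BlockNT)) :
    Relation.ReflTransGen M.BlockStep (X.map blockSymbol ++ .terminal a :: Q)
      (X.map (fun x => .terminal x.1) ++ .terminal a :: Q) := by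
  induction X using List.reverseRecOn generalizing a Q with
  | nil => exact .refl
  | append_singleton X x ih =>
    have := blockStep_of_blockRule (.left a x) (X.map blockSymbol) Q
    refine .head (by simpa using this) ?_
    simpa using ih x.1 (.terminal a :: Q)

/-- Linear boundedness keeps the head on the represented squares. Hence every step can be copied,
and the accepting state finally stands in some block. -/
theorem derives_of_mem_language (hM : M.IsLinearBounded) {w : List A} (hw : w ≠ [])
    (h : w ∈ M.language) : Relation.ReflTransGen M.BlockStep [.nonterminal .start]
      (w.map .terminal) := by
  obtain ⟨k, d, h1, h2⟩ := h
  obtain ⟨U, h3, h4, h5⟩ := derives_initial (M := M) hw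
  obtain ⟨V, h6, h7, h8⟩ := derives_of_stepsTo h3 h4 (fun j e he => hM w j e he) h1
  obtain ⟨hd1, hd2⟩ := hM w k d h1
  have hmem : (d.tape d.head, some d.state) ∈ expand V := by
    rw [h7]
    refine List.mem_map.2 ⟨d.head.toNat, List.mem_range.2 (by omega), ?_⟩
    simp [cellAt, Int.toNat_of_nonneg hd1]
  obtain ⟨x, hx, hx'⟩ := List.mem_flatMap.1 hmem
  obtain ⟨X, Y, rfl⟩ := List.append_of_mem hx
  refine h5.trans (h8.trans ?_)
  rw [← h6]
  have e1 := blockStep_of_blockRule (M := M) (.accept (x := x) h2 (by simpa [expand] using hx'))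
    (X.map blockSymbol) (Y.map blockSymbol)
  refine .head (by simpa using e1) ?_
  refine (derives_left X x.1 _).trans ?_
  simpa [Function.comp_def] using derives_right (X.map fun x => .terminal x.1) x.1 Y

/-! Generated words are accepted by the machine. -/

/-- The input letter of a symbol. -/
def symbolLetter : Symbol A M.BlockNT → Option A
  | .terminal a => some a
  | .nonterminal (.block x) => some x.1
  | _ => none

variable (M) in
/-- The sentential forms of the grammar. -/
inductive SententialForm : List (Symbol A M.BlockNT) → Prop
  | start : SententialForm [.nonterminal .start]
  | grow (U : List M.Block) (h : expand U = (U.map Prod.fst).map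
      (fun a => (some (M.input a), none)) ++ [(none, none)]) :
      SententialForm (.nonterminal .grow :: U.map blockSymbol)
  | simulate (U : List M.Block) (k : ℕ) (c : M.Config)
      (h : M.StepsTo k (M.init (U.map Prod.fst)) c) (hU : expand U = cells U.length c) :
      SententialForm (U.map blockSymbol)
  | accepted (w : List A) (hw : w ∈ M.language) (u : List (Symbol A M.BlockNT))
      (hu : u.map symbolLetter = w.map some) : SententialForm u

theorem StepsTo.snoc {k : ℕ} {c d e : M.Config} (h : M.StepsTo k c d) (h' : M.Step d e) :
    M.StepsTo (k + 1) c e := by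
  induction k generalizing c with
  | zero => obtain rfl : c = d := h; exact ⟨e, h', rfl⟩
  | succ k ih => obtain ⟨f, h1, h2⟩ := h; exact ⟨f, h1, ih h2⟩

theorem symbolLetter_comp_blockSymbol (U : List M.Block) :
    (U.map blockSymbol).map symbolLetter = (U.map Prod.fst).map some := by
  simp [Function.comp_def, symbolLetter]

theorem blockSymbol_injective : Function.Injective (blockSymbol (M := M)) := by
  intro x y h
  simpa using h

/-- No square holds a state before growth ends, so simulation starts from an initial configuration.
From then on blocks represent a reachable configuration, and a letter can appear only by acceptance.
After that the squares no longer matter, since all applicable productions keep the sequence of input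
letters. -/
theorem SententialForm.produces {u v : List (Symbol A M.BlockNT)} (h : M.SententialForm u)
    (h' : M.BlockStep u v) : M.SententialForm v := by
  obtain ⟨x, y, α, β, hr, hu, rfl⟩ := h'
  rw [eq_comm] at hu
  have letters : ∀ {α β : List (Symbol A M.BlockNT)}, M.BlockRule α β →
      (∀ s ∈ α, symbolLetter s ≠ none) → α.map symbolLetter = β.map symbolLetter := by
    intro α β hr hα
    cases hr with
    | step hW h hs => rw [symbolLetter_comp_blockSymbol, symbolLetter_comp_blockSymbol, h]
    | _ => simp_all [symbolLetter]
  have expand_init : ∀ (a : A) (U : List M.Block), expand U = (U.map Prod.fst).map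
      (fun a => (some (M.input a), none)) ++ [(none, none)] →
      expand ((a, (some (M.input a), some M.start), none) :: U) =
        cells (U.length + 1) (M.init (a :: U.map Prod.fst)) := by
    intro a U h
    have := cells_init (M := M) a (U.map Prod.fst)
    rw [List.length_cons, List.length_map] at this
    rw [this, expand_cons, h]
    simp
  cases h with
  | accepted w hw _ hu' =>
    -- The symbols `start` and `grow` carry no letter and cannot occur any more.
    have hs : ∀ s ∈ α, symbolLetter s ≠ none := by
      intro s hs h0
      have : symbolLetter s ∈ w.map some := by
        rw [← hu', ← hu]; exact List.mem_map_of_mem (by simp [hs])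
      rw [h0] at this
      simp at this
    refine .accepted w hw _ ?_
    rw [← hu', ← hu]
    simp [letters hr hs]
  | start =>
    have hne : α ≠ [] := by
      rintro rfl
      generalize hα : ([] : List (Symbol A M.BlockNT)) = α at hr
      cases hr with
      | @step W W' hW h hs =>
        exact ne_nil_of_cellStep hs (List.map_eq_nil_iff.1 hα.symm)
      | _ => simp at hα
    have : x = [] ∧ y = [] ∧ α = [.nonterminal .start] := by
      obtain ⟨s, α, rfl⟩ := List.exists_cons_of_ne_nil hne
      rcases x with _ | ⟨s', x⟩
      · rcases y with _ | ⟨s', y⟩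
        · simpa using hu
        · simp at hu
      · simp at hu
    obtain ⟨rfl, rfl, rfl⟩ := this
    simp only [List.nil_append, List.append_nil]
    generalize hα : [Symbol.nonterminal BlockNT.start] = α at hr
    cases hr with
    | single a =>
      refine .simulate [(a, (some (M.input a), some M.start), some (none, none))] 0 _ rfl ?_
      have := cells_init (M := M) a []
      simp only [List.length_singleton, List.map_cons, List.map_nil] at this ⊢
      rw [this]
      simp [expand]
    | last a =>
      exact .grow [(a, (some (M.input a), none), some (none, none))] (by simp [expand])
    | @step W W' hW h hs =>
      rcases W with _ | ⟨b, W⟩ <;> simp at hα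
    | _ => simp at hα
  | grow U hU =>
    cases hr with
    | single a =>
      have : Symbol.nonterminal BlockNT.start ∈
        (.nonterminal .grow :: U.map blockSymbol : List (Symbol A M.BlockNT)) := by
        rw [← hu]; simp
      simp at this
    | last a =>
      have : Symbol.nonterminal BlockNT.start ∈
        (.nonterminal .grow :: U.map blockSymbol : List (Symbol A M.BlockNT)) := by
        rw [← hu]; simp
      simp at this
    | right a b =>
      have : Symbol.terminal a ∈
        (.nonterminal .grow :: U.map blockSymbol : List (Symbol A M.BlockNT)) := by
        rw [← hu]; simp
      simp at this
    | left a b =>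
      have : Symbol.terminal a ∈
        (.nonterminal .grow :: U.map blockSymbol : List (Symbol A M.BlockNT)) := by
        rw [← hu]; simp
      simp at this
    | more a =>
      rcases x with _ | ⟨s, x⟩
      · simp only [List.nil_append, List.cons_append, List.cons.injEq, true_and] at hu
        subst hu
        refine .grow ((a, (some (M.input a), none), none) :: U) ?_
        rw [expand_cons, hU]; simp
      · simp only [List.cons_append, List.cons.injEq] at hu
        have : Symbol.nonterminal BlockNT.grow ∈ U.map (blockSymbol (M := M)) := by
          rw [← hu.2]; simp
        simp at this
    | first a =>
      rcases x with _ | ⟨s, x⟩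
      · simp only [List.nil_append, List.cons_append, List.cons.injEq, true_and] at hu
        subst hu
        exact .simulate ((a, (some (M.input a), some M.start), none) :: U) 0 _ rfl
          (expand_init a U hU)
      · simp only [List.cons_append, List.cons.injEq] at hu
        have : Symbol.nonterminal BlockNT.grow ∈ U.map (blockSymbol (M := M)) := by
          rw [← hu.2]; simp
        simp at this
    | @step W W' hW h hs =>
      -- A local rule needs a square with a state, and there is none yet.
      exfalso
      obtain ⟨p, q, α, β, h1, h2, -⟩ := hs
      obtain ⟨b, s, hb⟩ : ∃ b s, (b, some s) ∈ α := by
        cases h1 <;> simp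
      have hmem : (b, some s) ∈ expand W := by rw [h2]; simp [hb]
      obtain ⟨z, hz, hz'⟩ := List.mem_flatMap.1 hmem
      have hzU : z ∈ U := by
        have : blockSymbol z ∈
            (.nonterminal .grow :: U.map blockSymbol : List (Symbol A M.BlockNT)) := by
          rw [← hu]; simp [hz]
        simpa using this
      have : (b, some s) ∈ expand U := List.mem_flatMap.2 ⟨z, hzU, hz'⟩
      rw [hU] at this
      simp at this
    | @accept z b s hq h =>
      exfalso
      have hzU : z ∈ U := by
        have : blockSymbol z ∈
            (.nonterminal .grow :: U.map blockSymbol : List (Symbol A M.BlockNT)) := by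
          rw [← hu]; simp
        simpa using this
      have : (b, some s) ∈ expand U :=
        List.mem_flatMap.2 ⟨z, hzU, by simpa [expand] using h⟩
      rw [hU] at this
      simp at this
  | simulate U k c h hU =>
    have notMem : ∀ s : Symbol A M.BlockNT, s ∈ α → ∃ z ∈ U, s = blockSymbol z := by
      intro s hs
      have : s ∈ U.map blockSymbol := by rw [← hu]; simp [hs]
      obtain ⟨z, hz, rfl⟩ := List.mem_map.1 this
      exact ⟨z, hz, rfl⟩
    cases hr with
    | @step W W' hW hl hs =>
      rw [eq_comm, List.map_eq_append_iff] at hu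
      obtain ⟨X, U', rfl, rfl, hu⟩ := hu
      rw [List.map_eq_append_iff] at hu
      obtain ⟨W₁, Y, rfl, hW₁, rfl⟩ := hu
      obtain rfl := List.map_injective_iff.2 blockSymbol_injective hW₁
      obtain ⟨p, q, α, β, h1, h2, h3⟩ := hs
      have hlen : W₁.length = W'.length := by simpa using congrArg List.length hl
      -- The squares of the blocks around `W₁` merely extend the context of the local rule.
      obtain ⟨d, h4, h5⟩ := exists_step_of_cellStep (n := (X ++ (W₁ ++ Y)).length) (c := c)
        (v := expand (X ++ (W' ++ Y)))
        ⟨expand X ++ p, q ++ expand Y, α, β, h1, by rw [← hU]; simp [expand_append, h2],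
          by simp [expand_append, h3]⟩
      have := SententialForm.simulate (X ++ (W' ++ Y)) (k + 1) d (StepsTo.snoc (by
        simpa [hl] using h) h4) (by rw [h5]; simp [hlen])
      simpa using this
    | @accept z b s hq hz =>
      have hzU : z ∈ U := by
        obtain ⟨z', hz', he⟩ := notMem (blockSymbol z) (by simp)
        rwa [blockSymbol_injective he]
      have hmem : (b, some s) ∈ expand U :=
        List.mem_flatMap.2 ⟨z, hzU, by simpa [expand] using hz⟩
      rw [hU] at hmem
      obtain ⟨j, -, hj⟩ := List.mem_map.1 hmem
      refine .accepted (U.map Prod.fst) ⟨k, c, h, ?_⟩ _ ?_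
      · rw [(cellAt_eq_some hj).2.1]; exact hq
      · rw [← symbolLetter_comp_blockSymbol, ← hu]
        simp [symbolLetter]
    | single => obtain ⟨z, -, hz⟩ := notMem (.nonterminal .start) (by simp); simp at hz
    | last => obtain ⟨z, -, hz⟩ := notMem (.nonterminal .start) (by simp); simp at hz
    | more => obtain ⟨z, -, hz⟩ := notMem (.nonterminal .grow) (by simp); simp at hz
    | first => obtain ⟨z, -, hz⟩ := notMem (.nonterminal .grow) (by simp); simp at hz
    | right a => obtain ⟨z, -, hz⟩ := notMem (.terminal a) (by simp); simp at hz
    | left a => obtain ⟨z, -, hz⟩ := notMem (.terminal a) (by simp); simp at hz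

/-- Of the possible sentential forms, only the accepted ones can be nonempty words of terminals. -/
theorem mem_language_of_derives {w : List A} (hw : w ≠ [])
    (h : Relation.ReflTransGen M.BlockStep [.nonterminal .start] (w.map .terminal)) :
    w ∈ M.language := by
  have key : ∀ v, Relation.ReflTransGen M.BlockStep [.nonterminal .start] v →
      M.SententialForm v := by
    intro v hv
    induction hv with
    | refl => exact .start
    | tail _ h ih => exact ih.produces h
  have h := key _ h
  obtain ⟨a, v, rfl⟩ := List.exists_cons_of_ne_nil hw
  generalize hu : (a :: v).map Symbol.terminal = u at h
  cases h with
  | start => simp at hu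
  | grow U => simp at hu
  | simulate U => cases U <;> simp at hu
  | accepted w' hw' _ h =>
    have : w' = a :: v := by
      rw [← hu, List.map_map] at h
      exact (List.map_injective_iff.2 (Option.some_injective A) h).symm
    exact this ▸ hw'

/-- The grammar that simulates a linear-bounded automaton. -/
def blockGrammar [Finite A] (M : NTM A) : ContextSensitiveGrammar A where
  NT := M.BlockNT
  finiteNT := M.finite_blockNT
  start := .start
  rules := {ρ | M.BlockRule ρ.1 ρ.2}
  finiteRules := by
    have := M.finite_blockNT
    have : Finite (Symbol A M.BlockNT) := by
      refine Finite.of_surjective (α := A ⊕ M.BlockNT)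
        (Sum.elim Symbol.terminal Symbol.nonterminal) ?_
      rintro (a | X)
      · exact ⟨Sum.inl a, rfl⟩
      · exact ⟨Sum.inr X, rfl⟩
    -- Both sides of every production have length at most two over a finite alphabet.
    refine ((List.finite_length_le (Symbol A M.BlockNT) 2).prod
      (List.finite_length_le (Symbol A M.BlockNT) 2)).subset ?_
    rintro ⟨α, β⟩ h
    have h : M.BlockRule α β := h
    constructor
    · cases h <;> simp_all
    · cases h with
      | step hW hl =>
        have := congrArg List.length hl
        simp only [List.length_map] at this
        simpa [← this] using hW
      | _ => simp
  hasNonterminal := by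
    rintro ⟨α, β⟩ h
    have h : M.BlockRule α β := h
    cases h with
    | @step W W' hW h hs =>
      obtain ⟨x, W, rfl⟩ := List.exists_cons_of_ne_nil (ne_nil_of_cellStep hs)
      exact ⟨.block x, by simp⟩
    | _ => simp
  nondecreasing := by
    rintro ⟨α, β⟩ h
    have h : M.BlockRule α β := h
    cases h with
    | step hW hl =>
      have := congrArg List.length hl
      simp only [List.length_map] at this ⊢
      omega
    | _ => simp

theorem produces_iff_blockStep [Finite A] (u v : List (Symbol A M.BlockNT)) :
    M.blockGrammar.Produces u v ↔ M.BlockStep u v := by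
  constructor
  · rintro ⟨ρ, h, x, y, h1, h2⟩
    exact ⟨x, y, ρ.1, ρ.2, h, h1.trans (List.append_assoc _ _ _), h2.trans (List.append_assoc _ _ _)⟩
  · rintro ⟨x, y, α, β, h, h1, h2⟩
    exact ⟨(α, β), h, x, y, h1.trans (List.append_assoc _ _ _).symm,
      h2.trans (List.append_assoc _ _ _).symm⟩

theorem mem_language_blockGrammar_iff [Finite A] (w : List A) : w ∈ M.blockGrammar.language ↔
    Relation.ReflTransGen M.BlockStep [.nonterminal .start] (w.map .terminal) :=
  ⟨fun h => Relation.ReflTransGen.mono (fun u v h => (produces_iff_blockStep u v).1 h) _ _ h,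
    fun h => Relation.ReflTransGen.mono (fun u v h => (produces_iff_blockStep u v).2 h) _ _ h⟩

/-- The language of a linear-bounded automaton is context-sensitive, if it does not contain the
empty word. -/
theorem isContextSensitive [Finite A] (hM : M.IsLinearBounded) (hnil : [] ∉ M.language) :
    IsContextSensitive M.language := by
  refine ⟨M.blockGrammar, Set.ext fun w => ⟨fun h => ?_, fun h => ?_⟩⟩
  · have h := (mem_language_blockGrammar_iff w).1 h
    refine mem_language_of_derives ?_ h
    rintro rfl
    -- Productions never shorten, so nothing empty is derived from the start symbol.
    have len : ∀ v, Relation.ReflTransGen M.BlockStep [.nonterminal .start] v →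
        1 ≤ v.length := by
      intro v hv
      induction hv with
      | refl => simp
      | tail _ h ih =>
        obtain ⟨x, y, α, β, hr, rfl, rfl⟩ := h
        have : α.length ≤ β.length := M.blockGrammar.nondecreasing (α, β) hr
        simp only [List.length_append] at ih ⊢
        omega
    have := len _ h
    simp at this
  · exact (mem_language_blockGrammar_iff w).2
      (derives_of_mem_language hM (fun h0 => hnil (h0 ▸ h)) h)

end NTM

/-! ### Occurrences of patterns as tuples of positions in a codeword -/

/-- The entry that the letter at position `z` of a word inserts. -/
def entryValue (w : List Letter) (z : ℕ) : ℕ :=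
  1 + (w.take z).countP (· ≠ Letter.t)

/-- The letter at position `z` inserts an entry. -/
def InsertsAt (w : List Letter) (z : ℕ) : Prop :=
  ∃ y, w[z]? = some y ∧ y ≠ Letter.t

/-- Positions of a word that hold an occurrence of a pattern in `B`, according to the left-to-right
order `L` of the inserted entries and to the order `lt` of the positions. -/
def IsOccurrence {K : ℕ} (B : List (List ℝ)) (L lt : Fin K → Fin K → Prop) : Prop :=
  ∃ q ∈ B, (∀ a : Fin K, a < q.length → L a a) ∧
    ∀ (a b : Fin K) (ha : a < q.length) (hb : b < q.length), a < b →
      L a b ∧ (lt a b ↔ q[a] < q[b])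

/-- The left-to-right order of the entries inserted at the positions `x a`. -/
def PositionOrder {K : ℕ} (w : List Letter) (x : Fin K → ℕ) (a b : Fin K) : Prop :=
  InsertsAt w (x a) ∧ InsertsAt w (x b) ∧
    (a = b ∨ [entryValue w (x a), entryValue w (x b)].Sublist (decode w))

/-! ### Entries and the positions of their letters. -/

theorem entryValue_succ {w : List Letter} {z : ℕ} {y : Letter} (h : w[z]? = some y) :
    entryValue w (z + 1) = entryValue w z + if y = Letter.t then 0 else 1 := by
  unfold entryValue
  rw [List.take_add_one, h]
  by_cases hy : y = Letter.t <;> simp [hy, add_assoc]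

theorem entryValue_mono (w : List Letter) {z z' : ℕ} (h : z ≤ z') :
    entryValue w z ≤ entryValue w z' := by
  unfold entryValue
  exact Nat.add_le_add_left ((List.take_prefix_take_left h).sublist.countP_le) 1

theorem entryValue_lt {w : List Letter} {z z' : ℕ} (h : z < z') (hz : InsertsAt w z) :
    entryValue w z < entryValue w z' := by
  obtain ⟨y, hy, hyt⟩ := hz
  have h1 : entryValue w (z + 1) ≤ entryValue w z' := entryValue_mono w h
  have h2 := entryValue_succ hy
  rw [if_neg hyt] at h2
  omega

/-- Entries are inserted in increasing order, so an automaton never needs their values. -/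
theorem entryValue_lt_iff {w : List Letter} {z z' : ℕ} (hz : InsertsAt w z)
    (hz' : InsertsAt w z') : entryValue w z < entryValue w z' ↔ z < z' := by
  refine ⟨fun h => ?_, fun h => entryValue_lt h hz⟩
  by_contra h'
  rcases Nat.lt_or_eq_of_le (not_lt.1 h') with h1 | rfl
  · exact absurd (entryValue_lt h1 hz') (by omega)
  · exact lt_irrefl _ h

theorem InsertsAt.lt_length {w : List Letter} {z : ℕ} (h : InsertsAt w z) : z < w.length := by
  obtain ⟨y, hy, -⟩ := h
  exact (List.getElem?_eq_some_iff.1 hy).1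

theorem exists_insertsAt {w : List Letter} {e : ℕ} (h1 : 1 ≤ e)
    (h2 : e ≤ w.countP (· ≠ Letter.t)) : ∃ z, InsertsAt w z ∧ entryValue w z = e := by
  induction w using List.reverseRecOn with
  | nil => simp at h2; omega
  | append_singleton w y ih =>
    by_cases h : e ≤ w.countP (· ≠ Letter.t)
    · obtain ⟨z, hz, hz'⟩ := ih h
      have hl := hz.lt_length
      refine ⟨z, ?_, ?_⟩
      · obtain ⟨y', hy', hyt⟩ := hz
        exact ⟨y', by rw [List.getElem?_append_left hl, hy'], hyt⟩
      · rw [← hz', entryValue, List.take_append_of_le_length hl.le, entryValue]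
    · have hy : y ≠ Letter.t := by
        rintro rfl
        simp at h2 h
        omega
      refine ⟨w.length, ⟨y, by simp, hy⟩, ?_⟩
      rw [List.countP_append, List.countP_singleton] at h2
      simp only [hy, ne_eq, not_false_eq_true, decide_true, if_true] at h2
      simp only [entryValue, List.take_left']
      simp only [ne_eq] at h ⊢
      omega

theorem IsCodeword.mem_decode_iff {w : List Letter} (hw : IsCodeword w) (e : ℕ) :
    e ∈ decode w ↔ ∃ z, InsertsAt w z ∧ entryValue w z = e := by
  rw [hw.perm_decode_range.mem_iff, List.mem_range'_1]
  constructor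
  · rintro ⟨h1, h2⟩
    exact exists_insertsAt h1 (by omega)
  · rintro ⟨z, hz, rfl⟩
    have := entryValue_lt hz.lt_length hz
    refine ⟨by unfold entryValue; omega, ?_⟩
    rwa [entryValue, entryValue, List.take_length, ← entryValue] at this

/-- In a list without repetitions the order of any selection is determined by its pairs. This makes
a binary relation on the marked positions sufficient for detecting patterns; membership must be
assumed separately for the sake of singletons. -/
theorem sublist_of_pairwise {α : Type*} {p s : List α} (hp : p.Nodup) (hs : ∀ e ∈ s, e ∈ p)
    (h : s.Pairwise fun a b => [a, b].Sublist p) : s.Sublist p := by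
  induction p generalizing s with
  | nil =>
    rw [show s = [] from List.eq_nil_iff_forall_not_mem.2 fun e he => by simpa using hs e he]
  | cons c p ih =>
    rw [List.nodup_cons] at hp
    have drop : ∀ {a b}, [a, b].Sublist (c :: p) → a ≠ c → [a, b].Sublist p := by
      intro a b h hac
      cases h with
      | cons _ h => exact h
      | cons_cons _ h => exact absurd rfl hac
    have mem : ∀ {a b}, [a, b].Sublist (c :: p) → b ∈ p := by
      intro a b h
      cases h with
      | cons _ h => exact h.subset (by simp)
      | cons_cons _ h => exact h.subset (by simp)
    cases s with
    | nil => simp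
    | cons e s =>
      rw [List.pairwise_cons] at h
      have hs' : ∀ f ∈ s, f ∈ p := fun f hf => mem (h.1 f hf)
      have hne : ∀ f ∈ s, f ≠ c := fun f hf hfc => hp.1 (hfc ▸ hs' f hf)
      have hpw : s.Pairwise fun a b => [a, b].Sublist p :=
        h.2.imp_of_mem fun ha _ hab => drop hab (hne _ ha)
      by_cases hec : e = c
      · subst hec
        exact (ih hp.2 hs' hpw).cons_cons e
      · refine (ih hp.2 ?_ ?_).cons c
        · intro f hf
          rcases List.mem_cons.1 hf with rfl | hf
          · have := hs f (by simp)
            simpa [hec] using this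
          · exact hs' f hf
        · rw [List.pairwise_cons]
          exact ⟨fun f hf => drop (h.1 f hf) hec, hpw⟩

theorem pair_sublist_getElem {α : Type*} (s : List α) {a b : ℕ} (hb : b < s.length) (hab : a < b) :
    [s[a], s[b]].Sublist s := by
  have : s.Pairwise fun a b => [a, b].Sublist s :=
    List.pairwise_iff_forall_sublist.2 fun h => h
  exact List.pairwise_iff_getElem.1 this a b (by omega) hb hab

theorem not_sublist_swap {α : Type*} {l : List α} (hl : l.Nodup) {a b : α}
    (h : [a, b].Sublist l) : ¬ [b, a].Sublist l := by
  intro h'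
  induction l with
  | nil => simp at h
  | cons c l ih =>
    rw [List.nodup_cons] at hl
    cases h with
    | cons _ h =>
      cases h' with
      | cons _ h' => exact ih hl.2 h h'
      | cons_cons _ h' => exact hl.1 (h.subset (by simp))
    | cons_cons _ h =>
      cases h' with
      | cons _ h' => exact hl.1 (h'.subset (by simp))
      | cons_cons _ h' => exact hl.1 (h'.subset (by simp))

/-- A pattern `q` uses only the first `q.length` of the `K` coordinates, so tuples of one fixed size
serve all patterns of `B`. -/
theorem exists_isOccurrence_iff {K : ℕ} {B : List (List ℝ)} (hK : ∀ q ∈ B, q.length ≤ K)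
    {w : List Letter} (hw : IsCodeword w) :
    (∃ x : Fin K → ℕ, (∀ a, x a ≤ w.length) ∧
      IsOccurrence B (PositionOrder w x) (fun a b => x a < x b)) ↔
    ∃ q ∈ B, ContainsPattern (decode w) q := by
  constructor
  · rintro ⟨x, -, q, hq, h1, h2⟩
    have hqK := hK q hq
    let s : List ℕ := List.ofFn fun a : Fin q.length => entryValue w (x ⟨a, by omega⟩)
    refine ⟨q, hq, s, ?_, by simp [s], ?_⟩
    · refine sublist_of_pairwise hw.nodup_decode ?_ ?_
      · intro e he
        obtain ⟨a, rfl⟩ := (List.mem_ofFn' _ _).1 he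
        exact (hw.mem_decode_iff _).2 ⟨_, (h1 ⟨a, by omega⟩ a.2).1, rfl⟩
      · rw [List.pairwise_ofFn]
        intro a b hab
        have := (h2 ⟨a, by omega⟩ ⟨b, by omega⟩ a.2 b.2 hab).1.2.2
        rcases this with h | h
        · rw [Fin.mk.injEq] at h
          exact absurd (Fin.ext h) hab.ne
        · exact h
    · intro i j hij
      have hi : (i : ℕ) < q.length := by simpa [s] using i.2
      have hj : (j : ℕ) < q.length := by simpa [s] using j.2
      have := h2 ⟨i, by omega⟩ ⟨j, by omega⟩ hi hj hij
      simp only [s, List.get_eq_getElem, List.getElem_ofFn, Fin.val_cast]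
      rw [entryValue_lt_iff this.1.1 this.1.2.1]
      exact this.2
  · rintro ⟨q, hq, s, hs, hl, h⟩
    have hqK := hK q hq
    have hx : ∀ a : Fin K, ∃ z ≤ w.length, ∀ ha : a < s.length,
        InsertsAt w z ∧ entryValue w z = s[a] := by
      intro a
      by_cases ha : a < s.length
      · obtain ⟨z, hz, hz'⟩ := (hw.mem_decode_iff s[a]).1 (hs.subset (List.getElem_mem ha))
        exact ⟨z, hz.lt_length.le, fun _ => ⟨hz, hz'⟩⟩
      -- Coordinates beyond the length of the pattern are arbitrary.
      · exact ⟨0, Nat.zero_le _, fun ha' => absurd ha' ha⟩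
    choose x hx1 hx2 using hx
    refine ⟨x, hx1, q, hq, ?_, ?_⟩
    · intro a ha
      have := (hx2 a (by omega)).1
      exact ⟨this, this, Or.inl rfl⟩
    · intro a b ha hb hab
      obtain ⟨a1, a2⟩ := hx2 a (by omega)
      obtain ⟨b1, b2⟩ := hx2 b (by omega)
      refine ⟨⟨a1, b1, Or.inr ?_⟩, ?_⟩
      · rw [a2, b2]
        exact (pair_sublist_getElem s (by omega) hab).trans hs
      · change x a < x b ↔ _
        rw [← entryValue_lt_iff a1 b1, a2, b2]
        exact h ⟨a, by omega⟩ ⟨b, by omega⟩ hab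

/-! ### The order of the entries during a run -/

/-- The entry `e` has `c` open slots on its left. -/
def HasSlotsLeft (p : List (Option ℕ)) (e c : ℕ) : Prop :=
  ∃ A B, p = A ++ some e :: B ∧ A.count none = c

theorem HasSlotsLeft.le {p : List (Option ℕ)} {e c : ℕ} (h : HasSlotsLeft p e c) :
    c ≤ p.count none := by
  obtain ⟨A, B, rfl, rfl⟩ := h
  simp

section

variable {p : List (Option ℕ)} {i s : ℕ} {x : Letter}

theorem hasSlotsLeft_new (hx : x ≠ Letter.t) (hs : s < p.count none) :
    HasSlotsLeft (replaceSlot (slotContent i x) s p) i (s + (slotLeft x).length) := by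
  obtain ⟨A, B, rfl, rfl, h⟩ := exists_replaceSlot p s hs
  refine ⟨A ++ slotLeft x, slotRight x ++ B, ?_, ?_⟩
  · rw [h, slotContent_eq i hx]; simp
  · rcases slotLeft_eq x with h | h <;> simp [h]

theorem slotContent_sublist (hx : x ≠ Letter.t) : [some i].Sublist (slotContent i x) := by
  cases x <;> simp_all [slotContent]

/-- The slots to the left of `e` are the first `c`; as `c ≤ s`, the filled slot is not among them
and lies to the right of `e`. -/
theorem HasSlotsLeft.replaceSlot_of_le {e c : ℕ} (h : HasSlotsLeft p e c) (hx : x ≠ Letter.t)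
    (hs : s < p.count none) (hc : c ≤ s) :
    HasSlotsLeft (replaceSlot (slotContent i x) s p) e c ∧
      [some e, some i].Sublist (replaceSlot (slotContent i x) s p) := by
  obtain ⟨A, B, hp, rfl, h'⟩ := exists_replaceSlot p s hs
  obtain ⟨A', B', rfl, rfl⟩ := h
  rw [h']
  rcases List.append_eq_append_iff.1 hp with ⟨C, rfl, hC⟩ | ⟨C, rfl, hC⟩
  · rcases C with _ | ⟨o, C⟩
    · simp at hC
    · simp only [List.cons_append, List.cons.injEq] at hC
      obtain ⟨rfl, rfl⟩ := hC
      refine ⟨⟨A', C ++ (slotContent i x ++ B), by simp, rfl⟩, ?_⟩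
      have h1 : [some e].Sublist (A' ++ some e :: C) := by simp
      have h2 : [some i].Sublist (slotContent i x ++ B) :=
        (slotContent_sublist hx).trans (List.sublist_append_left _ _)
      exact h1.append h2
  · rcases C with _ | ⟨o, C⟩
    · simp at hC
    · simp only [List.cons_append, List.cons.injEq] at hC
      obtain ⟨rfl, rfl⟩ := hC
      simp at hc

/-- Now the filled slot is one of the `c` slots to the left of `e`, so their number changes as the
total number does. -/
theorem HasSlotsLeft.replaceSlot_of_lt {e c : ℕ} (h : HasSlotsLeft p e c) (hx : x ≠ Letter.t)
    (hs : s < p.count none) (hc : s < c) :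
    HasSlotsLeft (replaceSlot (slotContent i x) s p) e (slotsAfter c x) ∧
      [some i, some e].Sublist (replaceSlot (slotContent i x) s p) := by
  obtain ⟨A, B, hp, rfl, h'⟩ := exists_replaceSlot p s hs
  obtain ⟨A', B', rfl, rfl⟩ := h
  rw [h']
  rcases List.append_eq_append_iff.1 hp with ⟨C, rfl, hC⟩ | ⟨C, rfl, hC⟩
  · exfalso
    simp only [List.count_append] at hc
    omega
  · rcases C with _ | ⟨o, C⟩
    · simp at hC
    · simp only [List.cons_append, List.cons.injEq] at hC
      obtain ⟨rfl, rfl⟩ := hC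
      refine ⟨⟨A ++ (slotContent i x ++ C), B', by simp, ?_⟩, ?_⟩
      · have := count_slotContent i hx (A.count none + C.count none)
        simp only [List.count_append, List.count_cons_self]
        rw [← add_assoc (A.count none) (C.count none), ← this]
        omega
      · have h1 : [some i].Sublist (A ++ slotContent i x) :=
          (slotContent_sublist hx).trans (List.sublist_append_right _ _)
        have h2 : [some e].Sublist (C ++ some e :: B') := by simp
        simpa using h1.append h2

theorem sublist_replaceSlot {a b : ℕ} (hs : s < p.count none)
    (h : [some a, some b].Sublist p) (new : List (Option ℕ)) :
    [some a, some b].Sublist (replaceSlot new s p) := by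
  obtain ⟨A, B, rfl, rfl, h'⟩ := exists_replaceSlot p s hs
  rw [h']
  -- A pair of entries involves no slot, and without slots the old list is a sublist of the new one.
  have h1 := h.filter Option.isSome
  simp only [List.filter_append, Option.isSome_none, Bool.false_eq_true, not_false_eq_true,
    List.filter_cons_of_neg] at h1
  refine (by simpa using h1 : [some a, some b].Sublist _).trans ?_
  exact List.filter_sublist.append (List.filter_sublist.trans (List.sublist_append_right _ _))

end

/-! ### A counter machine for pattern avoidance -/

open CounterMachine

/-- The counters: the current position in the word and the next one, the number of open slots, the
number of slots to the left of the next slot, the marked positions, and the numbers of slots to the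
left of the entries inserted there. -/
inductive AvoidCounter (K : ℕ)
  | here
  | next
  | slots
  | slot
  | left (a : Fin K)
  | mark (a : Fin K)

/-- The states: before and during a reading of the word, and the accepting state. While the word is
read, the machine stores the left-to-right order of the marked entries that have been inserted. -/
inductive AvoidState (K : ℕ)
  | reset
  | read (L : Fin K → Fin K → Prop)
  | accept

namespace AvoidCounter

variable {K : ℕ}

instance : Finite (AvoidCounter K) := by
  refine Finite.of_surjective (α := Fin 4 ⊕ Fin K ⊕ Fin K) (fun
    | Sum.inl 0 => here
    | Sum.inl 1 => next
    | Sum.inl 2 => slots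
    | Sum.inl 3 => slot
    | Sum.inr (Sum.inl a) => left a
    | Sum.inr (Sum.inr a) => mark a) ?_
  intro j
  cases j with
  | here => exact ⟨Sum.inl 0, rfl⟩
  | next => exact ⟨Sum.inl 1, rfl⟩
  | slots => exact ⟨Sum.inl 2, rfl⟩
  | slot => exact ⟨Sum.inl 3, rfl⟩
  | left a => exact ⟨Sum.inr (Sum.inl a), rfl⟩
  | mark a => exact ⟨Sum.inr (Sum.inr a), rfl⟩

instance : Finite (AvoidState K) := by
  refine Finite.of_surjective (α := Option (Option (Fin K → Fin K → Prop))) (fun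
    | none => AvoidState.reset
    | some none => AvoidState.accept
    | some (some L) => AvoidState.read L) ?_
  intro q
  cases q with
  | reset => exact ⟨none, rfl⟩
  | accept => exact ⟨some none, rfl⟩
  | read L => exact ⟨some (some L), rfl⟩

/-! Tests on the view of a counter machine. -/

/-- The test `v j ≤ v k`. -/
def ViewLe {A J : Type} (S : Set (A × (J → Prop))) (j k : J) : Prop := ∀ γ ∈ S, γ.2 j → γ.2 k

/-- The test whether `v j` is the length of the word. -/
def ViewFull {A J : Type} (S : Set (A × (J → Prop))) (j : J) : Prop := ∀ γ ∈ S, γ.2 j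

/-- The test `v j = 0`. -/
def ViewZero {A J : Type} (S : Set (A × (J → Prop))) (j : J) : Prop := ∀ γ ∈ S, ¬ γ.2 j

/-- The test whether `y` is the letter at the current position. -/
def ViewLetter {A : Type} (S : Set (A × (AvoidCounter K → Prop))) (y : A) : Prop :=
  ∃ γ ∈ S, γ.1 = y ∧ ¬ γ.2 here ∧ γ.2 next

theorem mem_view {A J : Type} {w : List A} {v : J → ℕ} {γ : A × (J → Prop)} :
    γ ∈ view w v ↔ ∃ z, ∃ h : z < w.length, γ = (w[z], fun j => z < v j) := by
  constructor
  · rintro ⟨z, a, hz, ha, rfl⟩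
    exact ⟨z, hz, by rw [List.getElem?_eq_getElem hz] at ha; rw [Option.some.inj ha]⟩
  · rintro ⟨z, hz, rfl⟩
    exact ⟨z, w[z], hz, List.getElem?_eq_getElem hz, rfl⟩

/-- If the inequality fails, the column at the square `v k` shows it; the bound on `v j` guarantees
that this square exists. -/
theorem viewLe_iff {A J : Type} {w : List A} {v : J → ℕ} {j k : J} (hj : v j ≤ w.length) :
    ViewLe (view w v) j k ↔ v j ≤ v k := by
  constructor
  · intro h
    by_contra hlt
    have h1 : v k < w.length := by omega
    have := h _ (mem_view.2 ⟨v k, h1, rfl⟩) (by simpa using hlt)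
    simp at this
  · intro h γ hγ
    obtain ⟨z, hz, rfl⟩ := mem_view.1 hγ
    exact fun h' => lt_of_lt_of_le h' h

theorem viewFull_iff {A J : Type} {w : List A} {v : J → ℕ} {j : J} (hj : v j ≤ w.length) :
    ViewFull (view w v) j ↔ v j = w.length := by
  constructor
  · intro h
    by_contra hne
    have := h _ (mem_view.2 ⟨v j, by omega, rfl⟩)
    simp at this
  · intro h γ hγ
    obtain ⟨z, hz, rfl⟩ := mem_view.1 hγ
    simpa [h] using hz

theorem viewZero_iff {A J : Type} {w : List A} {v : J → ℕ} {j : J} (hw : w ≠ []) :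
    ViewZero (view w v) j ↔ v j = 0 := by
  constructor
  · intro h
    have := h _ (mem_view.2 ⟨0, List.length_pos_iff.2 hw, rfl⟩)
    simpa using this
  · intro h γ hγ
    obtain ⟨z, hz, rfl⟩ := mem_view.1 hγ
    simp [h]

/-- The current position is the only square covered by `next` and not by `here`; this is the purpose
of the second counter. -/
theorem viewLetter_iff {A : Type} {w : List A} {v : AvoidCounter K → ℕ} {y : A}
    (h : v next = v here + 1) : ViewLetter (view w v) y ↔ w[v here]? = some y := by
  constructor
  · rintro ⟨γ, hγ, rfl, h1, h2⟩
    obtain ⟨z, hz, rfl⟩ := mem_view.1 hγ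
    simp only [h] at h1 h2
    obtain rfl : z = v here := by omega
    exact List.getElem?_eq_getElem hz
  · intro hy
    obtain ⟨hz, rfl⟩ := List.getElem?_eq_some_iff.1 hy
    exact ⟨_, mem_view.2 ⟨v here, hz, rfl⟩, rfl, by simp, by simp [h]⟩

/-! The operations of the machine. -/

/-- The operation on a number of slots to the left of an entry if the letter `y` is read and if the
next slot is one of them. -/
def slotsOp (y : Letter) (j : AvoidCounter K) : CounterOp (AvoidCounter K) :=
  match y with
  | Letter.m => .succ j
  | Letter.f => .pred j
  | _ => .copy j

theorem apply_slotsOp (y : Letter) (j : AvoidCounter K) {n : ℕ} {v : AvoidCounter K → ℕ}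
    (hj : v j ≤ n) : (slotsOp y j).apply n v = min n (slotsAfter (v j) y) := by
  cases y <;> simp [slotsOp, slotsAfter, CounterOp.apply, hj]
  omega

/-- The operations at the beginning of a reading. -/
def resetOp : AvoidCounter K → CounterOp (AvoidCounter K)
  | here => .zero
  | next => .one
  | slots => .one
  | slot => .zero
  | left a => .copy (left a)
  | mark a => .copy (mark a)

open Classical in
/-- The operations when the letter `y` is read. -/
noncomputable def readOp (S : Set (Letter × (AvoidCounter K → Prop))) (y : Letter) :
    AvoidCounter K → CounterOp (AvoidCounter K)
  | here => .copy next
  | next => .succ next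
  | slots => slotsOp y slots
  | slot => if y = Letter.t then .succ slot else .zero
  | left a =>
    if y = Letter.t then .copy (left a)
    else if ViewLe S (mark a) here ∧ ViewLe S here (mark a) then
      if slotLeft y = [] then .copy slot else .succ slot
    else if ViewLe S (left a) slot then .copy (left a) else slotsOp y (left a)
  | mark a => .copy (mark a)

open Classical in
/-- The left-to-right order of the marked entries after the letter `y` is read. -/
noncomputable def readOrder (S : Set (Letter × (AvoidCounter K → Prop))) (y : Letter)
    (L : Fin K → Fin K → Prop) (a b : Fin K) : Prop :=
  if y = Letter.t then L a b
  else if ViewLe S (mark a) here ∧ ViewLe S here (mark a) then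
    if ViewLe S (mark b) here ∧ ViewLe S here (mark b) then a = b
    else L b b ∧ ¬ ViewLe S (left b) slot
  else if ViewLe S (mark b) here ∧ ViewLe S here (mark b) then L a a ∧ ViewLe S (left a) slot
  else L a b

open Classical in
/-- The operations that pass to the next tuple of marked positions. -/
noncomputable def advanceOp (S : Set (Letter × (AvoidCounter K → Prop))) :
    AvoidCounter K → CounterOp (AvoidCounter K)
  | mark a =>
    if ∀ b < a, ViewFull S (mark b) then
      if ViewFull S (mark a) then .zero else .succ (mark a)
    else .copy (mark a)
  | j => .copy j

open Classical in
/-- The transitions of the machine. -/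
noncomputable def avoidTrans (B : List (List ℝ)) :
    AvoidState K → Set (Letter × (AvoidCounter K → Prop)) →
      Option (AvoidState K × (AvoidCounter K → CounterOp (AvoidCounter K)))
  | .reset, _ => some (.read (fun _ _ => False), resetOp)
  | .read L, S =>
    if ViewFull S here then
      if ViewZero S slots ∧ ViewZero S slot ∧
          ¬ IsOccurrence B L (fun a b => ¬ ViewLe S (mark b) (mark a)) then
        if ∀ a, ViewFull S (mark a) then some (.accept, .copy) else some (.reset, advanceOp S)
      else none
    else if h : ∃ y, ViewLetter S y then
      if h.choose ≠ Letter.t ∧ ViewLe S slots slot then none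
      else some (.read (readOrder S h.choose L), readOp S h.choose)
    else none
  | .accept, _ => none

variable (K) in
/-- The machine that reads a word once for each tuple of `K` marked positions, to check that the
word is a codeword and that the marked entries are not an occurrence of a pattern. -/
noncomputable abbrev avoidMachine (B : List (List ℝ)) :
    CounterMachine Letter (AvoidCounter K) where
  State := AvoidState K
  finiteState := inferInstance
  start := .reset
  accept := {.accept}
  trans := avoidTrans B

/-! One reading of the word. -/

/-- The invariant of a reading: the first `i` letters of `w` have been read, `s` slots are to the
left of the next slot, and `p` is the partially built permutation. -/
structure ReadInvariant (w : List Letter) (x : Fin K → ℕ) (i s : ℕ) (p : List (Option ℕ))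
    (L : Fin K → Fin K → Prop) (v : AvoidCounter K → ℕ) : Prop where
  le_length : i ≤ w.length
  run : insertLetters w 1 0 [none] = insertLetters (w.drop i) (entryValue w i) s p
  canComplete : CanComplete w 0 1 ↔ CanComplete (w.drop i) s (p.count none)
  slot_le : s ≤ i
  slots_le : p.count none ≤ i + 1
  here_eq : v here = i
  next_eq : v next = min w.length (i + 1)
  slots_eq : v slots = min w.length (p.count none)
  slot_eq : v slot = s
  mark_eq : ∀ a, v (mark a) = x a
  left_le : ∀ a, v (left a) ≤ w.length
  left_eq : ∀ a, x a < i → InsertsAt w (x a) →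
    ∃ c, HasSlotsLeft p (entryValue w (x a)) c ∧ v (left a) = min w.length c
  diag : ∀ a, L a a ↔ x a < i ∧ InsertsAt w (x a)
  sound : ∀ a b, a ≠ b → L a b → L a a ∧ L b b ∧
    [some (entryValue w (x a)), some (entryValue w (x b))].Sublist p
  total : ∀ a b, L a a → L b b → x a ≠ x b → L a b ∨ L b a

variable {w : List Letter} {x : Fin K → ℕ} {i s : ℕ} {p : List (Option ℕ)}
  {L : Fin K → Fin K → Prop} {v : AvoidCounter K → ℕ}

/-- The counters `left a` still hold values of an earlier reading. The invariant says what they mean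
only after the position `x a` has been read. -/
theorem readInvariant_start (hx : ∀ a, v (mark a) = x a)
    (hv : ∀ j, v j ≤ w.length) :
    ReadInvariant w x 0 0 [none] (fun _ _ => False)
      (fun j => (resetOp j).apply w.length v) where
  le_length := Nat.zero_le _
  run := by simp [entryValue]
  canComplete := by simp
  slot_le := le_rfl
  slots_le := by simp
  here_eq := rfl
  next_eq := rfl
  slots_eq := by simp [resetOp, CounterOp.apply]
  slot_eq := rfl
  mark_eq := hx
  left_le := fun a => hv _
  left_eq := fun a h => absurd h (Nat.not_lt_zero _)
  diag := by simp
  sound := by simp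
  total := by simp

theorem ReadInvariant.viewMark (h : ReadInvariant w x i s p L v) (hx : ∀ a, x a ≤ w.length)
    (a : Fin K) : ViewLe (view w v) (mark a) here ∧ ViewLe (view w v) here (mark a) ↔ x a = i := by
  rw [viewLe_iff (by rw [h.mark_eq]; exact hx a), viewLe_iff (by rw [h.here_eq]; exact h.le_length),
    h.mark_eq, h.here_eq]
  omega

theorem ReadInvariant.step_t (h : ReadInvariant w x i s p L v) (hy : w[i]? = some Letter.t) :
    ReadInvariant w x (i + 1) (s + 1) p (readOrder (view w v) Letter.t L)
      (fun j => (readOp (view w v) Letter.t j).apply w.length v) := by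
  obtain ⟨hi, hy'⟩ := List.getElem?_eq_some_iff.1 hy
  have hd : w.drop i = Letter.t :: w.drop (i + 1) := by
    rw [List.drop_eq_getElem_cons hi, hy']
  have hL : readOrder (view w v) Letter.t L = L := by
    funext a b; simp [readOrder]
  -- A mark on a letter `t` designates no entry.
  have hins : ∀ a, x a < i + 1 ∧ InsertsAt w (x a) ↔ x a < i ∧ InsertsAt w (x a) := by
    intro a
    constructor
    · rintro ⟨h1, h2⟩
      refine ⟨lt_of_le_of_ne (by omega) ?_, h2⟩
      intro he
      obtain ⟨y, hy1, hy2⟩ := h2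
      rw [he, hy] at hy1
      exact hy2 (Option.some.inj hy1).symm
    · rintro ⟨h1, h2⟩
      exact ⟨by omega, h2⟩
  rw [hL]
  exact
  { le_length := hi
    run := by rw [h.run, hd, entryValue_succ hy]; rfl
    canComplete := by rw [h.canComplete, hd, canComplete_t]
    slot_le := by have := h.slot_le; omega
    slots_le := by have := h.slots_le; omega
    here_eq := by
      simp only [readOp, CounterOp.apply, h.next_eq]; omega
    next_eq := by
      simp only [readOp, CounterOp.apply, h.next_eq]; omega
    slots_eq := by
      simp only [readOp, slotsOp, CounterOp.apply, h.slots_eq]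
    slot_eq := by
      have := h.slot_le
      simp only [readOp, CounterOp.apply, h.slot_eq, if_true]; omega
    mark_eq := fun a => by simp only [readOp, CounterOp.apply, h.mark_eq]
    left_le := fun a => by simp only [readOp, CounterOp.apply, if_true, h.left_le]
    left_eq := fun a ha1 ha2 => by
      simp only [readOp, CounterOp.apply, if_true]
      exact h.left_eq a ((hins a).1 ⟨ha1, ha2⟩).1 ha2
    diag := fun a => by rw [hins, h.diag]
    sound := h.sound
    total := h.total }

/-- While a letter is left, there are at most `i + 1 ≤ w.length` open slots, so the cap on the
counter has no effect. After the last letter the counter is only tested for zero. -/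
theorem ReadInvariant.le_slots (h : ReadInvariant w x i s p L v) (hi : i < w.length) :
    v slots = p.count none := by
  have := h.slots_le
  rw [h.slots_eq]; omega

/-- Comparing `left a` with `slot` tells on which side of an earlier marked entry the new one falls.
The same comparison decides whether the number of slots to the left of that entry changes. -/
theorem ReadInvariant.step (h : ReadInvariant w x i s p L v) (hx : ∀ a, x a ≤ w.length)
    {y : Letter} (hy : w[i]? = some y) (hyt : y ≠ Letter.t) (hs : s < p.count none) :
    ReadInvariant w x (i + 1) 0 (replaceSlot (slotContent (entryValue w i) y) s p)
      (readOrder (view w v) y L)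
      (fun j => (readOp (view w v) y j).apply w.length v) := by
  obtain ⟨hi, hy'⟩ := List.getElem?_eq_some_iff.1 hy
  have hd : w.drop i = y :: w.drop (i + 1) := by
    rw [List.drop_eq_getElem_cons hi, hy']
  have hev : entryValue w (i + 1) = entryValue w i + 1 := by
    rw [entryValue_succ hy, if_neg hyt]
  have hcnt := count_replaceSlot (entryValue w i) hyt hs
  have hslots := h.slots_le
  have hmark := h.viewMark hx
  have hleft : ∀ a, ViewLe (view w v) (left a) slot ↔ v (left a) ≤ s := fun a => by
    rw [viewLe_iff (h.left_le a), h.slot_eq]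
  have hlt : ∀ a, ¬ x a = i → (x a < i + 1 ↔ x a < i) := fun a ha => by omega
  have hins : InsertsAt w i := ⟨y, hy, hyt⟩
  have hcount : ∀ c ≤ p.count none, c ≤ w.length := fun c hc => by omega
  have old : ∀ a, L a a → ∃ c, HasSlotsLeft p (entryValue w (x a)) c ∧ v (left a) = c := by
    intro a ha
    obtain ⟨h1, h2⟩ := (h.diag a).1 ha
    obtain ⟨c, hc, hc'⟩ := h.left_eq a h1 h2
    exact ⟨c, hc, by rw [hc', min_eq_right (hcount c hc.le)]⟩
  have hLi : ∀ a, L a a → x a ≠ i := fun a ha => ((h.diag a).1 ha).1.ne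
  have hdiag : ∀ a, readOrder (view w v) y L a a ↔ x a < i + 1 ∧ InsertsAt w (x a) := by
    intro a
    simp only [readOrder, if_neg hyt, hmark]
    by_cases ha : x a = i
    · simp [ha, hins]
    · simp [ha, h.diag, hlt a ha]
  exact
  { le_length := hi
    run := by rw [h.run, hd, hev, insertLetters_cons y hyt]
    canComplete := by
      rw [h.canComplete, hd, canComplete_cons hyt, hcnt]
      exact ⟨fun h => h.2, fun h => ⟨hs, h⟩⟩
    slot_le := Nat.zero_le _
    slots_le := by
      rw [hcnt]
      cases y <;> simp [slotsAfter] <;> omega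
    here_eq := by
      simp only [readOp, CounterOp.apply, h.next_eq]; omega
    next_eq := by
      simp only [readOp, CounterOp.apply, h.next_eq]; omega
    slots_eq := by
      have : v slots = p.count none := h.le_slots hi
      simp only [readOp]
      rw [apply_slotsOp _ _ (by omega), hcnt, this]
    slot_eq := by simp only [readOp, if_neg hyt, CounterOp.apply]
    mark_eq := fun a => by simp only [readOp, CounterOp.apply, h.mark_eq]
    left_le := fun a => CounterOp.apply_le (fun j => by
      cases j with
      | here => rw [h.here_eq]; exact hi.le
      | next => rw [h.next_eq]; exact min_le_left _ _
      | slots => rw [h.slots_eq]; exact min_le_left _ _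
      | slot => rw [h.slot_eq]; have := h.slot_le; omega
      | left a => exact h.left_le a
      | mark a => rw [h.mark_eq]; exact hx a) _
    left_eq := fun a ha1 ha2 => by
      simp only [readOp, if_neg hyt, hmark, hleft]
      by_cases ha : x a = i
      -- The new entry has `s` slots on its left, and one more if its letter leaves a slot there.
      · rw [if_pos ha, ha]
        refine ⟨_, hasSlotsLeft_new hyt hs, ?_⟩
        have := hcount s hs.le
        rcases slotLeft_eq y with hl | hl
        · simp [hl, CounterOp.apply, h.slot_eq, this]
        · simp [hl, CounterOp.apply, h.slot_eq]
      · rw [if_neg ha]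
        have hLa := (h.diag a).2 ⟨(hlt a ha).1 ha1, ha2⟩
        obtain ⟨c, hc, hc'⟩ := old a hLa
        by_cases hcs : v (left a) ≤ s
        · rw [if_pos hcs]
          refine ⟨c, (hc.replaceSlot_of_le hyt hs (by omega)).1, ?_⟩
          simp only [CounterOp.apply]
          rw [hc', min_eq_right (hcount c hc.le)]
        · rw [if_neg hcs]
          refine ⟨_, (hc.replaceSlot_of_lt hyt hs (by omega)).1, ?_⟩
          rw [apply_slotsOp _ _ (h.left_le a), hc']
    diag := hdiag
    sound := fun a b hab hL => by
      simp only [hdiag]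
      simp only [readOrder, if_neg hyt, hmark, hleft] at hL
      split_ifs at hL with ha hb hb
      · exact absurd hL hab
      · obtain ⟨hLb, hb'⟩ := hL
        obtain ⟨c, hc, hc'⟩ := old b hLb
        obtain ⟨h1, h2⟩ := (h.diag b).1 hLb
        refine ⟨⟨by omega, ha ▸ hins⟩, ⟨by omega, h2⟩, ?_⟩
        rw [ha]
        exact (hc.replaceSlot_of_lt hyt hs (by omega)).2
      · obtain ⟨hLa, ha'⟩ := hL
        obtain ⟨c, hc, hc'⟩ := old a hLa
        obtain ⟨h1, h2⟩ := (h.diag a).1 hLa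
        refine ⟨⟨by omega, h2⟩, ⟨by omega, hb ▸ hins⟩, ?_⟩
        rw [hb]
        exact (hc.replaceSlot_of_le hyt hs (by omega)).2
      · obtain ⟨hLa, hLb, hsub⟩ := h.sound a b hab hL
        obtain ⟨h1, h2⟩ := (h.diag a).1 hLa
        obtain ⟨h3, h4⟩ := (h.diag b).1 hLb
        exact ⟨⟨by omega, h2⟩, ⟨by omega, h4⟩, sublist_replaceSlot hs hsub _⟩
    total := fun a b ha hb hab => by
      simp only [hdiag] at ha hb
      simp only [readOrder, if_neg hyt, hmark, hleft]
      by_cases ha' : x a = i <;> by_cases hb' : x b = i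
      · exact absurd (ha'.trans hb'.symm) hab
      · have hLb := (h.diag b).2 ⟨(hlt b hb').1 hb.1, hb.2⟩
        simp only [ha', hb', if_true, if_false, hLb, true_and]
        -- Of a marked old entry and the new one, the comparison always puts exactly one first.
        exact (em _).symm
      · have hLa := (h.diag a).2 ⟨(hlt a ha').1 ha.1, ha.2⟩
        simp only [ha', hb', if_true, if_false, hLa, true_and]
        exact em _
      · simp only [ha', hb', if_false]
        exact h.total a b ((h.diag a).2 ⟨(hlt a ha').1 ha.1, ha.2⟩)
          ((h.diag b).2 ⟨(hlt b hb').1 hb.1, hb.2⟩) hab }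

theorem ReadInvariant.le (h : ReadInvariant w x i s p L v) (hx : ∀ a, x a ≤ w.length)
    (j : AvoidCounter K) : v j ≤ w.length := by
  cases j with
  | here => rw [h.here_eq]; exact h.le_length
  | next => rw [h.next_eq]; exact min_le_left _ _
  | slots => rw [h.slots_eq]; exact min_le_left _ _
  | slot => rw [h.slot_eq]; exact h.slot_le.trans h.le_length
  | left a => exact h.left_le a
  | mark a => rw [h.mark_eq]; exact hx a

/-- At the end of the reading of a codeword, the machine knows the order of the marked entries. -/
theorem ReadInvariant.positionOrder (h : ReadInvariant w x w.length s p L v)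
    (hw : IsCodeword w) : L = PositionOrder w x := by
  have hnd := hw.nodup_decode
  have hp : p.reduceOption = decode w := by
    rw [decode, h.run, List.drop_length]; rfl
  have hsub : ∀ a b, a ≠ b → L a b →
      [entryValue w (x a), entryValue w (x b)].Sublist (decode w) := by
    intro a b hab hL
    have := (h.sound a b hab hL).2.2.filterMap id
    rw [← hp]
    simpa [List.reduceOption] using this
  have hdiag : ∀ a, L a a ↔ InsertsAt w (x a) := fun a => by
    rw [h.diag]
    exact ⟨fun h => h.2, fun h => ⟨h.lt_length, h⟩⟩
  funext a b
  apply propext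
  by_cases hab : a = b
  · subst hab
    rw [hdiag]
    exact ⟨fun h => ⟨h, h, Or.inl rfl⟩, fun h => h.1⟩
  · constructor
    · intro hL
      obtain ⟨h1, h2, -⟩ := h.sound a b hab hL
      exact ⟨(hdiag a).1 h1, (hdiag b).1 h2, Or.inr (hsub a b hab hL)⟩
    · rintro ⟨h1, h2, h3⟩
      have h3 := h3.resolve_left hab
      have hne : x a ≠ x b := by
        intro he
        rw [he] at h3
        have := hnd.sublist h3
        simp at this
      rcases h.total a b ((hdiag a).2 h1) ((hdiag b).2 h2) hne with h4 | h4
      · exact h4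
      · exfalso
        have h5 := hsub b a (Ne.symm hab) h4
        exact not_sublist_swap hnd h3 h5

end AvoidCounter

/-! ### Tuples of positions in the order in which the machine runs through them -/

/-- The position of a tuple with entries `≤ n` in the enumeration of all such tuples. -/
def tupleRank (n : ℕ) : {K : ℕ} → (Fin K → ℕ) → ℕ
  | 0, _ => 0
  | _ + 1, x => x 0 + (n + 1) * tupleRank n fun a => x a.succ

open Classical in
/-- The next tuple in the enumeration. -/
noncomputable def tupleAdvance (n : ℕ) {K : ℕ} (x : Fin K → ℕ) (a : Fin K) : ℕ :=
  if ∀ b < a, x b = n then if x a = n then 0 else x a + 1 else x a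

theorem tupleRank_lt {n K : ℕ} {x : Fin K → ℕ} (hx : ∀ a, x a ≤ n) :
    tupleRank n x < (n + 1) ^ K := by
  induction K with
  | zero => simp [tupleRank]
  | succ K ih =>
    have h1 := ih fun a => hx a.succ
    have h2 := hx 0
    rw [tupleRank, pow_succ]
    nlinarith

theorem tupleRank_injective {n K : ℕ} {x y : Fin K → ℕ} (hx : ∀ a, x a ≤ n) (hy : ∀ a, y a ≤ n)
    (h : tupleRank n x = tupleRank n y) : x = y := by
  induction K with
  | zero => exact Subsingleton.elim _ _
  | succ K ih =>
    rw [tupleRank, tupleRank] at h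
    have hx0 := Nat.lt_succ_of_le (hx 0)
    have hy0 := Nat.lt_succ_of_le (hy 0)
    have h0 : x 0 = y 0 := by
      have := congrArg (· % (n + 1)) h
      simpa [Nat.add_mul_mod_self_left, Nat.mod_eq_of_lt hx0, Nat.mod_eq_of_lt hy0] using this
    rw [h0] at h
    have h1 := Nat.eq_of_mul_eq_mul_left (Nat.succ_pos n) (Nat.add_left_cancel h)
    have h2 := ih (fun a => hx a.succ) (fun a => hy a.succ) h1
    funext a
    refine Fin.cases h0 (fun b => congrFun h2 b) a

theorem tupleRank_zero (n K : ℕ) : tupleRank n (fun _ : Fin K => 0) = 0 := by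
  induction K with
  | zero => rfl
  | succ K ih => simp [tupleRank, ih]

theorem tupleRank_full {n K : ℕ} {x : Fin K → ℕ} (hx : ∀ a, x a = n) :
    tupleRank n x + 1 = (n + 1) ^ K := by
  induction K with
  | zero => simp [tupleRank]
  | succ K ih =>
    have h := ih fun a => hx a.succ
    rw [tupleRank, hx 0, pow_succ, ← h]
    ring

theorem tupleAdvance_le {n K : ℕ} {x : Fin K → ℕ} (hx : ∀ a, x a ≤ n) (a : Fin K) :
    tupleAdvance n x a ≤ n := by
  have := hx a
  unfold tupleAdvance
  split_ifs <;> omega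

/-- A tuple is a number in base `n + 1` whose coordinate `0` is the lowest digit, and `tupleAdvance`
adds one with carries. -/
theorem tupleRank_advance {n K : ℕ} {x : Fin K → ℕ} (h : ¬ ∀ a, x a = n) :
    tupleRank n (tupleAdvance n x) = tupleRank n x + 1 := by
  induction K with
  | zero => exact absurd (fun a => a.elim0) h
  | succ K ih =>
    have h0 : tupleAdvance n x 0 = if x 0 = n then 0 else x 0 + 1 := by
      simp [tupleAdvance]
    have hs : (fun a : Fin K => tupleAdvance n x a.succ) =
        if x 0 = n then tupleAdvance n (fun a => x a.succ) else fun a => x a.succ := by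
      funext a
      have : (∀ b < a.succ, x b = n) ↔ x 0 = n ∧ ∀ b < a, x b.succ = n := by
        constructor
        · intro h
          exact ⟨h 0 (Fin.succ_pos a), fun b hb => h b.succ (Fin.succ_lt_succ_iff.2 hb)⟩
        · rintro ⟨h1, h2⟩ b
          refine Fin.cases (fun _ => h1) (fun b hb => h2 b (Fin.succ_lt_succ_iff.1 hb)) b
      split_ifs with hx <;> simp [tupleAdvance, this, hx]
    rw [tupleRank, tupleRank, h0, hs]
    split_ifs with hx
    · have : ¬ ∀ a : Fin K, x a.succ = n := fun h' => h fun a => Fin.cases hx h' a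
      rw [ih this, hx]
      ring
    · ring

/-! ### The readings for all tuples of positions. -/

namespace AvoidCounter

open CounterMachine

variable {K : ℕ} {B : List (List ℝ)} {w : List Letter} {x : Fin K → ℕ} {i s : ℕ}
  {p : List (Option ℕ)} {L : Fin K → Fin K → Prop} {v : AvoidCounter K → ℕ}

/-- The machine stops early only at a letter other than `t` for which there is no next slot, and
then the word is not a codeword. -/
theorem next_read (hx : ∀ a, x a ≤ w.length) (h : ReadInvariant w x i s p L v)
    (hi : i < w.length) :
    ((avoidMachine K B).next w (.read L, v) = none ∧ ¬ CanComplete w 0 1) ∨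
    ∃ L' v' s' p', (avoidMachine K B).next w (.read L, v) = some (.read L', v') ∧
      ReadInvariant w x (i + 1) s' p' L' v' := by
  have hfull : ¬ ViewFull (view w v) here := by
    rw [viewFull_iff (h.le hx _), h.here_eq]; omega
  have hnext : v next = v here + 1 := by rw [h.next_eq, h.here_eq]; omega
  have hletter : ∃ y, ViewLetter (view w v) y :=
    ⟨w[i], (viewLetter_iff hnext).2 (by rw [h.here_eq]; exact List.getElem?_eq_getElem hi)⟩
  have hy := (viewLetter_iff hnext).1 hletter.choose_spec
  rw [h.here_eq] at hy
  have hle : ViewLe (view w v) slots slot ↔ p.count none ≤ s := by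
    rw [viewLe_iff (h.le hx _), h.le_slots hi, h.slot_eq]
  have hval : avoidTrans B (.read L) (view w v) =
      if hletter.choose ≠ Letter.t ∧ p.count none ≤ s then none
      else some (.read (readOrder (view w v) hletter.choose L),
        readOp (view w v) hletter.choose) := by
    simp only [avoidTrans, if_neg hfull, dif_pos hletter, hle]
  simp only [CounterMachine.next, hval]
  -- The choice is immaterial, because `hy` determines the letter.
  generalize hletter.choose = y at hy
  by_cases hyt : y = Letter.t
  · subst hyt
    right
    exact ⟨_, _, _, _, by simp, h.step_t hy⟩
  · by_cases hs : s < p.count none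
    · right
      refine ⟨_, _, _, _, ?_, h.step hx hy hyt hs⟩
      rw [if_neg (by omega)]
      rfl
    · left
      refine ⟨by simp [hyt, not_lt.1 hs], ?_⟩
      obtain ⟨hi, hy'⟩ := List.getElem?_eq_some_iff.1 hy
      rw [h.canComplete, List.drop_eq_getElem_cons hi, hy', canComplete_cons hyt]
      exact fun h => hs h.1

theorem runs_read (hx : ∀ a, x a ≤ w.length) (h : ReadInvariant w x i s p L v) :
    (∃ k ≤ w.length - i, ∃ d, (avoidMachine K B).Runs w k (.read L, v) d ∧
      (avoidMachine K B).next w d = none ∧ d.1 ≠ .accept ∧ ¬ CanComplete w 0 1) ∨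
    ∃ L' v' s' p', (avoidMachine K B).Runs w (w.length - i) (.read L, v) (.read L', v') ∧
      ReadInvariant w x w.length s' p' L' v' := by
  obtain ⟨m, hm⟩ : ∃ m, w.length - i = m := ⟨_, rfl⟩
  rw [hm]
  induction m generalizing i s p L v with
  | zero =>
    right
    obtain rfl : i = w.length := by have := h.le_length; omega
    exact ⟨L, v, s, p, rfl, h⟩
  | succ m ih =>
    rcases next_read (B := B) hx h (by omega) with ⟨h1, h2⟩ | ⟨L', v', s', p', h1, h2⟩
    · exact Or.inl ⟨0, Nat.zero_le _, _, rfl, h1, by simp, h2⟩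
    · rcases ih h2 (by omega) with ⟨k, hk, d, h3, h4⟩ | ⟨L'', v'', s'', p'', h3, h4⟩
      · exact Or.inl ⟨k + 1, by omega, d, ⟨_, h1, h3⟩, h4⟩
      · exact Or.inr ⟨L'', v'', s'', p'', ⟨_, h1, h3⟩, h4⟩

variable (B w) in
/-- The reading with marked positions `x` succeeds. -/
def ReadingSucceeds (x : Fin K → ℕ) : Prop :=
  IsCodeword w ∧ ¬ IsOccurrence B (PositionOrder w x) (fun a b => x a < x b)

open Classical in
theorem trans_read_end (hw : w ≠ []) (hx : ∀ a, x a ≤ w.length)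
    (h : ReadInvariant w x w.length s p L v) :
    avoidTrans B (.read L) (view w v) =
      if ReadingSucceeds B w x then
        if ∀ a, x a = w.length then some (.accept, .copy)
        else some (.reset, advanceOp (view w v))
      else none := by
  have hl := List.length_pos_iff.2 hw
  have hfull : ViewFull (view w v) here := by
    rw [viewFull_iff (h.le hx _), h.here_eq]
  have hmark : ∀ a, ViewFull (view w v) (mark a) ↔ x a = w.length := fun a => by
    rw [viewFull_iff (h.le hx _), h.mark_eq]
  have hlt : (fun a b => ¬ ViewLe (view w v) (mark b) (mark a)) = fun a b => x a < x b := by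
    funext a b
    rw [viewLe_iff (h.le hx _), h.mark_eq, h.mark_eq, not_le]
  -- At the end of the word, `CanComplete` asks that no slot be open and no translation be pending;
  -- the cap cannot hide an open slot because `w` is nonempty.
  have hcode : ViewZero (view w v) slots ∧ ViewZero (view w v) slot ↔ IsCodeword w := by
    rw [viewZero_iff hw, viewZero_iff hw, h.slots_eq, h.slot_eq, isCodeword_iff_canComplete,
      h.canComplete, List.drop_length, CanComplete]
    omega
  have hcond : (ViewZero (view w v) slots ∧ ViewZero (view w v) slot ∧
      ¬ IsOccurrence B L (fun a b => ¬ ViewLe (view w v) (mark b) (mark a))) ↔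
      ReadingSucceeds B w x := by
    rw [← and_assoc, hcode, hlt, ReadingSucceeds]
    refine and_congr_right fun hc => ?_
    rw [h.positionOrder hc]
  simp only [avoidTrans, if_pos hfull, hcond, hmark]

theorem apply_advanceOp_mark {n : ℕ} (hn : w.length = n) (hv : ∀ j, v j ≤ n)
    (hx : ∀ a, v (mark a) = x a) (a : Fin K) :
    (advanceOp (view w v) (mark a)).apply n v = tupleAdvance n x a := by
  subst hn
  have hmark : ∀ a, ViewFull (view w v) (mark a) ↔ x a = w.length := fun a => by
    rw [viewFull_iff (hv _), hx]
  have := hv (mark a)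
  rw [hx] at this
  simp only [advanceOp, hmark, tupleAdvance]
  split_ifs <;> simp [CounterOp.apply, hx]
  omega

/-- Induction on the number `r` of tuples that come after `x`. A reading costs at most `w.length +
2` steps: the reset, the letters and the final decision. The machine stops at the first reading that
fails, so it accepts exactly if all remaining ones succeed. -/
theorem runs_reset (hw : w ≠ []) (r : ℕ) (hx : ∀ a, x a ≤ w.length) (hv : ∀ j, v j ≤ w.length)
    (hvx : ∀ a, v (mark a) = x a) (hr : tupleRank w.length x + r + 1 = (w.length + 1) ^ K) :
    ∃ k ≤ (r + 1) * (w.length + 2), ∃ d, (avoidMachine K B).Runs w k (.reset, v) d ∧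
      (avoidMachine K B).next w d = none ∧
      (d.1 = .accept ↔ ∀ y : Fin K → ℕ, (∀ a, y a ≤ w.length) →
        tupleRank w.length x ≤ tupleRank w.length y → ReadingSucceeds B w y) := by
  have hl := List.length_pos_iff.2 hw
  have h0 := readInvariant_start hvx hv
  have hstep : (avoidMachine K B).Runs w 1 (.reset, v)
      (.read (fun _ _ => False), fun j => (resetOp j).apply w.length v) := Runs.single rfl
  induction r using Nat.strong_induction_on generalizing x v with
  | _ r ih =>
    have hbound : w.length + 2 ≤ (r + 1) * (w.length + 2) := Nat.le_mul_of_pos_left _ (by omega)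
    rcases runs_read (B := B) hx h0 with ⟨k, hk, d, h1, h2, h3, h4⟩ | ⟨L, v', s, p, h1, h2⟩
    · refine ⟨1 + k, by omega, d, hstep.trans h1, h2, iff_of_false h3 fun h => h4 ?_⟩
      exact (isCodeword_iff_canComplete w).1 (h x hx le_rfl).1
    · rw [Nat.sub_zero] at h1
      have hend := trans_read_end (B := B) hw hx h2
      by_cases hsucc : ReadingSucceeds B w x
      · rw [if_pos hsucc] at hend
        by_cases hfull : ∀ a, x a = w.length
        · rw [if_pos hfull] at hend
          have h3 : (avoidMachine K B).next w (.read L, v') = some (.accept, v') := by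
            simp only [CounterMachine.next, hend]
            rfl
          refine ⟨1 + w.length + 1, by omega, _, (hstep.trans h1).trans (Runs.single h3), rfl,
            iff_of_true rfl fun y hy hxy => ?_⟩
          have h4 := tupleRank_lt hy
          have h5 := tupleRank_full hfull
          -- The tuple `x` has the largest rank, so no other tuple is left.
          rwa [← tupleRank_injective hx hy (by omega)]
        · rw [if_neg hfull] at hend
          have h3 : (avoidMachine K B).next w (.read L, v') =
              some (.reset, fun j => (advanceOp (view w v') j).apply w.length v') := by
            simp only [CounterMachine.next, hend]
            rfl
          have hx' := tupleAdvance_le hx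
          have h4 := tupleRank_advance (n := w.length) hfull
          have h5 := tupleRank_lt hx'
          -- The next tuple also has rank less than `(w.length + 1) ^ K`, so `r` cannot be zero.
          obtain ⟨r, rfl⟩ : ∃ r', r = r' + 1 := ⟨r - 1, by omega⟩
          have hv' : ∀ j, (advanceOp (view w v') j).apply w.length v' ≤ w.length :=
            fun j => CounterOp.apply_le (h2.le hx) _
          have hvx' := apply_advanceOp_mark rfl (h2.le hx) h2.mark_eq
          obtain ⟨k, hk, d, h6, h7, h8⟩ := ih r (by omega) hx' hv' hvx' (by omega)
            (readInvariant_start hvx' hv') (Runs.single rfl)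
          refine ⟨1 + w.length + 1 + k, ?_, d,
            ((hstep.trans h1).trans (Runs.single h3)).trans h6, h7, h8.trans ⟨?_, ?_⟩⟩
          · have : (r + 1 + 1) * (w.length + 2) = (r + 1) * (w.length + 2) + (w.length + 2) := by
              ring
            omega
          · intro h y hy hxy
            rcases hxy.eq_or_lt with hxy | hxy
            · rwa [← tupleRank_injective hx hy hxy]
            · exact h y hy (by omega)
          · exact fun h y hy hxy => h y hy (by omega)
      · rw [if_neg hsucc] at hend
        refine ⟨1 + w.length, by omega, _, hstep.trans h1, ?_,
          iff_of_false (by simp) fun h => hsucc (h x hx le_rfl)⟩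
        simp only [CounterMachine.next, hend]
        rfl

end AvoidCounter

/-! ### The automaton for the codewords and the corollary. -/

instance : Finite Letter :=
  Finite.of_surjective (α := Fin 5) ![.l, .r, .m, .f, .t] fun y => by
    cases y
    exacts [⟨0, rfl⟩, ⟨1, rfl⟩, ⟨2, rfl⟩, ⟨3, rfl⟩, ⟨4, rfl⟩]

theorem nil_notMem_codewordsAvoidingAll (B : List (List ℝ)) : [] ∉ codewordsAvoidingAll B := by
  rintro ⟨⟨-, ⟨u, hu⟩, -⟩, -⟩
  simp at hu

/-- Starting from the zero tuple, the machine runs through all `(w.length + 1) ^ K` tuples, which by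
`exists_isOccurrence_iff` include every occurrence of a pattern. -/
theorem exists_ntm_codewordsAvoidingAll (B : List (List ℝ)) :
    ∃ M : NTM Letter, M.IsLinearBounded ∧ M.RunsInPolynomialTime ∧
      M.language = codewordsAvoidingAll B := by
  obtain ⟨K, hK⟩ : ∃ K, ∀ q ∈ B, q.length ≤ K :=
    -- Any bound would do; for empty `B` it is `0`, and the only reading, for the empty tuple, just
    -- tests for a codeword.
    ⟨(B.map List.length).sum, fun q hq => List.le_sum_of_mem (List.mem_map_of_mem hq)⟩
  refine (AvoidCounter.avoidMachine K B).exists_ntm _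
    ((Polynomial.X + 1) ^ K * (Polynomial.X + 2)) (nil_notMem_codewordsAvoidingAll B) ?_
  intro w hw
  have hpos : 0 < (w.length + 1) ^ K := by positivity
  obtain ⟨k, hk, d, h1, h2, h3⟩ := AvoidCounter.runs_reset (K := K) (B := B)
    (x := fun _ => 0) (v := fun _ => 0) hw ((w.length + 1) ^ K - 1) (fun _ => Nat.zero_le _)
    (fun _ => Nat.zero_le _) (fun _ => rfl) (by rw [tupleRank_zero]; omega)
  refine ⟨k, ?_, d, h1, h2, ?_⟩
  · rw [Nat.sub_add_cancel hpos] at hk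
    simpa using hk
  · rw [Set.mem_singleton_iff, h3]
    simp only [tupleRank_zero, Nat.zero_le, forall_const]
    constructor
    · intro h
      have hw := (h (fun _ => 0) fun _ => Nat.zero_le _).1
      refine ⟨hw, fun q hq hc => ?_⟩
      obtain ⟨x, hx, hocc⟩ := (exists_isOccurrence_iff hK hw).2 ⟨q, hq, hc⟩
      exact (h x hx).2 hocc
    · rintro ⟨hw, h⟩ x hx
      refine ⟨hw, fun hocc => ?_⟩
      obtain ⟨q, hq, hc⟩ := (exists_isOccurrence_iff hK hw).1 ⟨x, hx, hocc⟩
      exact h q hq hc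

/-- The factor `codewords` matters only for empty `B`, where the infimum is the language of all
words. -/
theorem codewordsAvoidingAll_eq (B : List (List ℝ)) :
    codewordsAvoidingAll B = codewords ⊓ ⨅ q ∈ B, codewordsAvoiding q := by
  apply le_antisymm
  · exact le_inf (fun w h => h.1) (le_iInf₂ fun q hq w h => ⟨h.1, h.2 q hq⟩)
  · intro w h
    refine ⟨inf_le_left (b := ⨅ q ∈ B, codewordsAvoiding q) h, fun q hq => ?_⟩
    have hle : codewords ⊓ ⨅ q ∈ B, codewordsAvoiding q ≤ codewordsAvoiding q :=
      inf_le_right.trans (iInf₂_le q hq)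
    exact (hle h).2

theorem codewordsAvoidingAll_eq_iInf {B : List (List ℝ)} (hB : B ≠ []) :
    codewordsAvoidingAll B = ⨅ q ∈ B, codewordsAvoiding q := by
  rw [codewordsAvoidingAll_eq, inf_eq_right]
  obtain ⟨q, hq⟩ := List.exists_mem_of_ne_nil B hB
  exact (iInf₂_le q hq).trans fun w h => h.1

theorem mainTheorem2 (B : List (List ℝ)) (hB : ∀ q ∈ B, q.Nodup) :
    (∃ M : NTM Letter, M.IsLinearBounded ∧ M.RunsInPolynomialTime ∧
      M.language = codewordsAvoidingAll B) ∧
    codewordsAvoidingAll B = codewords ⊓ ⨅ q ∈ B, codewordsAvoiding q ∧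
    (B ≠ [] → codewordsAvoidingAll B = ⨅ q ∈ B, codewordsAvoiding q) ∧
    Set.BijOn decode (codewordsAvoidingAll B) (avoidanceClass B) ∧
    IsContextSensitive (codewordsAvoidingAll B) := by
  refine ⟨exists_ntm_codewordsAvoidingAll B, codewordsAvoidingAll_eq B,
    codewordsAvoidingAll_eq_iInf, bijOn_decode B, ?_⟩
  obtain ⟨M, hM, -, hL⟩ := exists_ntm_codewordsAvoidingAll B
  rw [← hL]
  exact NTM.isContextSensitive hM (hL ▸ nil_notMem_codewordsAvoidingAll B)
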